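/- Let $n\ge 2$, let $a_1,\dots,a_n>0$, and put $A=\mathrm{diag}(a_1,\dots,a_n)$, $\bar A=\mathrm{diag}(a_1,\dots,a_{n-1})$, $|\mathbf a|_1=a_1a_2\cdots a_n$. Write points of $\mathbb R^n$ as $x=(x',x_n)$ with $x'\in\mathbb R^{n-1}$. Let $f\in C^\infty(\mathbb R^n)$ (complex-valued) be even in $x_n$, with compact support contained in $\mathbb R^{n-1}\times(\mathbb R\setminus\{0\})$. The elliptical Radon transform of $f$ is $$R_{E,A}f(u,t)=\int_{\mathbb R^n} f(x)\,\delta\big(|A^{-1}(x-(u,0))|-t\big)\,dx=\lim_{\varepsilon\to0^+}\frac1{2\varepsilon}\int_{\{x:\ |\,|A^{-1}(x-(u,0))|-t\,|<\varepsilon\}}f(x)\,dx,\qquad (u,t)\in\mathbb R^{n-1}\times[0,\infty),$$ and for a function $h$ on $(0,\infty)$ put $$\Lambda_t h(t)=\int_{\mathbb R}\int_0^\infty e^{i(t^2-\tau^2)\beta}\,|\beta|^{n-1}h(\tau)\,d\tau\,d\beta .$$ Then the limit defining $R_{E,A}f(u,t)$ exists for all $(u,t)\in\mathbb R^{n-1}\times[0,\infty)$,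 and for every $x=(x',x_n)\in\mathbb R^n$ $$f(x)=\frac{|x_n|}{2\pi^{n}|\mathbf a|_1^2}\int_{\mathbb R^{n-1}}\Lambda_t(R_{E,A}f)(\alpha,t)\Big|_{t=\sqrt{|\bar A^{-1}(\alpha-x')|^2+a_n^{-2}x_n^2}}\;d\alpha ,$$ where each of the successive integrals (over $\tau$, then $\beta$, then $\alpha$) converges absolutely. For $n=2$ one has moreover, for every $x=(x_1,x_2)\in\mathbb R^2$, $$f(x)=-\frac{|x_2|}{\pi^2a_1^2a_2^2}\int_{\mathbb R}\left(\mathrm{f.p.}\!\int_0^\infty\frac{R_{E,A}f(\alpha,t)}{\big(|a_1^{-1}(\alpha-x_1)|^2+a_2^{-2}x_2^2-t^2\big)^2}\,dt\right)d\alpha ,$$ where the inner integral is understood in the sense of distributions, that is, as the Hadamard finite part: with $c=|a_1^{-1}(\alpha-x_1)|^2+a_2^{-2}x_2^2$, it is the limit as $\varepsilon\to0^+$ of the integral over $\{t>0:\ |c-t^2|>\varepsilon\}$ minus the divergent term $C/\varepsilon$, $C$ being the unique constant for which that limit exists. These finite parts exist for all $\alpha\in\mathbb R$ and the outer integral converges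 absolutely. -/

import Mathlib

open MeasureTheory Filter Topology
open scoped ContDiff

namespace EllipticalRadon

noncomputable section

/-- The point `(x', s)` of `ℝ^d × ℝ = ℝ^(d+1)`. -/
def point {d : ℕ} (x' : EuclideanSpace ℝ (Fin d)) (s : ℝ) : EuclideanSpace ℝ (Fin (d + 1)) :=
  WithLp.toLp 2 (Fin.snoc (α := fun _ => ℝ) (fun i => x' i) s)

/-- `A⁻¹ x` for the diagonal matrix `A = diag(a_1, ..., a_m)`. -/
def diagInv {m : ℕ} (a : Fin m → ℝ) (x : EuclideanSpace ℝ (Fin m)) : EuclideanSpace ℝ (Fin m) :=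
  WithLp.toLp 2 (fun i => (a i)⁻¹ * x i)

/-- Smooth functions on `ℝ^d × ℝ`, even in the last variable, with compact support in
`ℝ^d × (ℝ ∖ {0})`. -/
structure Admissible {d : ℕ} (f : EuclideanSpace ℝ (Fin (d + 1)) → ℂ) : Prop where
  smooth : ContDiff ℝ ∞ f
  compactSupport : HasCompactSupport f
  support_subset : tsupport f ⊆ {x | x (Fin.last d) ≠ 0}
  even : ∀ (x' : EuclideanSpace ℝ (Fin d)) (s : ℝ), f (point x' (-s)) = f (point x' s)

/-- `∫ f(x) δ(φ(x) - t) dx = L`, where `δ` is the limit of the normalized indicator functions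
`(2ε)⁻¹ 1_{(-ε, ε)}` as `ε → 0+`. -/
def HasDeltaIntegral {E : Type*} [MeasureSpace E] (φ : E → ℝ) (t : ℝ) (f : E → ℂ) (L : ℂ) : Prop :=
  Tendsto (fun ε : ℝ => (2 * ε)⁻¹ • ∫ x in {x | |φ x - t| < ε}, f x) (𝓝[>] 0) (𝓝 L)

/-- `∫ f(x) δ(φ(x) - t) dx`, as the value of the limit in `HasDeltaIntegral`. -/
def deltaIntegral {E : Type*} [MeasureSpace E] (φ : E → ℝ) (t : ℝ) (f : E → ℂ) : ℂ :=
  limUnder (𝓝[>] (0 : ℝ)) (fun ε : ℝ => (2 * ε)⁻¹ • ∫ x in {x | |φ x - t| < ε}, f x)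

/-- `x ↦ |A⁻¹ (x - (u, 0))|`; its level sets are the ellipsoids of integration. -/
def ellipsoidalRadius {d : ℕ} (a : Fin (d + 1) → ℝ) (u : EuclideanSpace ℝ (Fin d))
    (x : EuclideanSpace ℝ (Fin (d + 1))) : ℝ :=
  ‖diagInv a (x - point u 0)‖

/-- The elliptical Radon transform `∫ f(x) δ(|A⁻¹ (x - (u, 0))| - t) dx`. -/
def ellipticalRadon {d : ℕ} (a : Fin (d + 1) → ℝ) (f : EuclideanSpace ℝ (Fin (d + 1)) → ℂ)
    (u : EuclideanSpace ℝ (Fin d)) (t : ℝ) : ℂ :=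
  deltaIntegral (ellipsoidalRadius a u) t f

/-- `t = √(|Ā⁻¹ (α - x')|² + a_n⁻² x_n²)` with `Ā = diag(a_1, ..., a_{n-1})`. -/
def evalTime {d : ℕ} (a : Fin (d + 1) → ℝ) (x' : EuclideanSpace ℝ (Fin d)) (xn : ℝ)
    (α : EuclideanSpace ℝ (Fin d)) : ℝ :=
  Real.sqrt (‖diagInv (fun i : Fin d => a i.castSucc) (α - x')‖ ^ 2
    + ((a (Fin.last d)) ^ 2)⁻¹ * xn ^ 2)

/-- The integrand `e^{i (t² - τ²) β} |β|^{n-1} h(τ)` of `Λ`. -/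
def LambdaIntegrand (n : ℕ) (h : ℝ → ℂ) (t β τ : ℝ) : ℂ :=
  Complex.exp (Complex.I * (((t ^ 2 - τ ^ 2) * β : ℝ) : ℂ)) * ((|β| ^ (n - 1) : ℝ) : ℂ) * h τ

/-- `Λ h (t) = ∫_ℝ ∫_0^∞ e^{i (t² - τ²) β} |β|^{n-1} h(τ) dτ dβ`. -/
def Lambda (n : ℕ) (h : ℝ → ℂ) (t : ℝ) : ℂ :=
  ∫ β : ℝ, ∫ τ in Set.Ioi (0 : ℝ), LambdaIntegrand n h t β τ

/-- Both integrals of the iterated integral `Lambda n h t` converge absolutely. -/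
def LambdaConverges (n : ℕ) (h : ℝ → ℂ) (t : ℝ) : Prop :=
  (∀ β : ℝ, IntegrableOn (fun τ => LambdaIntegrand n h t β τ) (Set.Ioi 0)) ∧
    Integrable (fun β : ℝ => ∫ τ in Set.Ioi (0 : ℝ), LambdaIntegrand n h t β τ)

/-- `L` is the Hadamard finite part of `∫_0^∞ h(t) / (c - t²)² dt`: cut out the part where
`|c - t²| ≤ ε`, discard the divergent term `C / ε` and let `ε → 0+`. (The constant `C`, and hence
`L`, is determined by `h` and `c`.) This is the value on `h` of the distribution `x⁻²` composed
with `x = c - t²`. -/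
def HasFinitePart (h : ℝ → ℂ) (c : ℝ) (L : ℂ) : Prop :=
  (∀ ε : ℝ, 0 < ε →
      IntegrableOn (fun t : ℝ => h t / (((c - t ^ 2) ^ 2 : ℝ) : ℂ)) {t | 0 < t ∧ ε < |c - t ^ 2|}) ∧
    ∃ C : ℂ, Tendsto
      (fun ε : ℝ => (∫ t in {t : ℝ | 0 < t ∧ ε < |c - t ^ 2|}, h t / (((c - t ^ 2) ^ 2 : ℝ) : ℂ))
        - C / (ε : ℂ))
      (𝓝[>] 0) (𝓝 L)

end

end EllipticalRadon

open EllipticalRadon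

/-!
Pushing `f(x) dx` forward under `x ↦ A⁻¹ x` and then under `(y, s) ↦ (y, s²)` loses nothing, because
`f` is even in the last variable, and the density stays smooth, because `f` vanishes near the
hyperplane `x_n = 0`. It turns the ellipsoids of radius `t` centred at `(α, 0)` into the paraboloids
`v + |y - ᾱ|² = t²`, where `ᾱ = Ā⁻¹ α`. Hence `R f(α, t) = 2 t P(t²)`, where `P(s)` is the
integral of the new density `G` over the paraboloid `v + |y - ᾱ|² = s`, and the substitution
`s = τ²` makes `Λ (R f)(α, t)` a constant times the Riesz derivative of `P` of order `n - 1` at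
`t²`, i.e. the function obtained from `P` by the Fourier multiplier `|b|^(n-1)`.

The shear `(y, v) ↦ (y, v + |y|²)` makes these paraboloids parallel hyperplanes, so the Fourier
transform of `P` at `b` is, up to a phase, that of the sheared `G` at `(-2 b ᾱ, b)`. The factor
`|b|^(n-1)` is the Jacobian of `(ᾱ, b) ↦ (-2 b ᾱ, b)` up to a constant, so the integral over `α` is
Fourier inversion for the sheared `G`. For `n = 2` the multiplier `|b|` is convolution with the
finite part of `-1 / (2 π² s²)`, since `∫₀^∞ (1 - cos (b u)) / u² du = π |b| / 2`.
-/

namespace EllipticalRadon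

noncomputable section

open Set
open scoped FourierTransform RealInnerProductSpace

/-! ### The Riesz derivative and finite parts -/

section OneSubCos

variable {y : ℝ}

lemma re_cexp_sub_cexp (y u : ℝ) :
    (Complex.exp (-y * u) - Complex.exp ((-y + Complex.I) * u)).re
      = Real.exp (-(y * u)) * (1 - Real.cos u) := by
  simp only [neg_mul, Complex.sub_re, Complex.exp_re, Complex.neg_re, Complex.mul_re,
    Complex.ofReal_re, Complex.ofReal_im, mul_zero, sub_zero, Complex.neg_im, Complex.mul_im,
    zero_mul, add_zero, neg_zero, Real.cos_zero, mul_one, Complex.add_re, Complex.I_re,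
    Complex.add_im, Complex.I_im, zero_add, one_mul]
  ring

lemma integrableOn_cexp_sub_cexp (hy : 0 < y) :
    IntegrableOn (fun u : ℝ => Complex.exp (-y * u) - Complex.exp ((-y + Complex.I) * u))
      (Ioi 0) :=
  (integrableOn_exp_mul_complex_Ioi (by simpa) 0).sub
    (integrableOn_exp_mul_complex_Ioi (by simpa) 0)

lemma integrableOn_exp_neg_mul_one_sub_cos (hy : 0 < y) :
    IntegrableOn (fun u : ℝ => Real.exp (-(y * u)) * (1 - Real.cos u)) (Ioi 0) :=
  (integrableOn_cexp_sub_cexp hy).re.congr (Eventually.of_forall (re_cexp_sub_cexp y))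

lemma integral_exp_neg_mul_one_sub_cos (hy : 0 < y) :
    ∫ u in Ioi (0 : ℝ), Real.exp (-(y * u)) * (1 - Real.cos u) = y⁻¹ * (1 + y ^ 2)⁻¹ := by
  have hre := integral_re (integrableOn_cexp_sub_cexp hy)
  rw [integral_sub (integrableOn_exp_mul_complex_Ioi (by simpa) 0)
    (integrableOn_exp_mul_complex_Ioi (by simpa) 0), integral_exp_mul_complex_Ioi (by simpa),
    integral_exp_mul_complex_Ioi (by simpa)] at hre
  simp only [RCLike.re_eq_complex_re, re_cexp_sub_cexp] at hre
  rw [hre]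
  have : y ^ 2 + 1 ≠ 0 := by positivity
  simp only [Complex.ofReal_zero, mul_zero, Complex.exp_zero, Complex.sub_re, Complex.div_re,
    Complex.neg_re, Complex.neg_im, Complex.one_re, Complex.one_im, Complex.add_re,
    Complex.add_im, Complex.I_re, Complex.I_im, Complex.ofReal_re, Complex.ofReal_im,
    Complex.normSq_apply, neg_zero, add_zero, zero_add, mul_one, zero_div]
  field_simp
  ring

lemma integral_mul_exp_neg_mul (hy : 0 < y) :
    ∫ u in Ioi (0 : ℝ), u * Real.exp (-(y * u)) = (y ^ 2)⁻¹ := by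
  have h := Real.integral_rpow_mul_exp_neg_mul_Ioi two_pos hy
  norm_num at h
  simpa [Real.Gamma_two] using h

/-- Write `u⁻² = ∫ y exp (-u y) dy` and integrate in `u` first. -/
lemma lintegral_one_sub_cos_div_sq :
    ∫⁻ u in Ioi (0 : ℝ), ENNReal.ofReal ((1 - Real.cos u) / u ^ 2)
      = ENNReal.ofReal (Real.pi / 2) := by
  have hnonneg : ∀ y ∈ Ioi (0 : ℝ), ∀ u,
      0 ≤ y * (Real.exp (-(y * u)) * (1 - Real.cos u)) := fun y hy u =>
    mul_nonneg (le_of_lt hy) (mul_nonneg (Real.exp_pos _).le (sub_nonneg.2 (Real.cos_le_one u)))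
  have laplace : ∀ u ∈ Ioi (0 : ℝ), ENNReal.ofReal ((1 - Real.cos u) / u ^ 2)
      = ∫⁻ y in Ioi (0 : ℝ), ENNReal.ofReal (y * (Real.exp (-(y * u)) * (1 - Real.cos u))) := by
    intro u (hu : 0 < u)
    have hval := integral_mul_exp_neg_mul hu
    have hint : IntegrableOn (fun y : ℝ => y * Real.exp (-(u * y))) (Ioi 0) :=
      .of_integral_ne_zero (by rw [hval]; positivity)
    simp only [mul_comm _ u, ← mul_assoc]
    rw [← ofReal_integral_eq_lintegral_ofReal (hint.mul_const _), integral_mul_const, hval,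
      div_eq_inv_mul]
    filter_upwards [ae_restrict_mem measurableSet_Ioi] with y hy
    simpa only [Pi.zero_apply, mul_comm u, mul_assoc] using hnonneg y hy u
  have inner : ∀ y ∈ Ioi (0 : ℝ), ∫⁻ u in Ioi (0 : ℝ),
      ENNReal.ofReal (y * (Real.exp (-(y * u)) * (1 - Real.cos u)))
        = ENNReal.ofReal (1 + y ^ 2)⁻¹ := by
    intro y (hy : 0 < y)
    rw [← ofReal_integral_eq_lintegral_ofReal
      ((integrableOn_exp_neg_mul_one_sub_cos hy).const_mul y)
      (Eventually.of_forall (hnonneg y hy)), integral_const_mul,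
      integral_exp_neg_mul_one_sub_cos hy, mul_inv_cancel_left₀ hy.ne']
  rw [setLIntegral_congr_fun measurableSet_Ioi laplace,
    lintegral_lintegral_swap (Measurable.aemeasurable (by fun_prop)),
    setLIntegral_congr_fun measurableSet_Ioi inner, ← ofReal_integral_eq_lintegral_ofReal
      integrable_inv_one_add_sq.integrableOn (Eventually.of_forall fun y => by positivity)]
  simp

lemma integral_one_sub_cos_div_sq :
    ∫ u in Ioi (0 : ℝ), (1 - Real.cos u) / u ^ 2 = Real.pi / 2 := by
  rw [integral_eq_lintegral_of_nonneg_ae, lintegral_one_sub_cos_div_sq,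
    ENNReal.toReal_ofReal (by positivity)]
  · exact Eventually.of_forall fun u =>
      div_nonneg (sub_nonneg.2 (Real.cos_le_one u)) (sq_nonneg u)
  · exact Measurable.aestronglyMeasurable (by fun_prop)

lemma integral_one_sub_cos_mul_div_sq (β : ℝ) :
    ∫ u in Ioi (0 : ℝ), (1 - Real.cos (β * u)) / u ^ 2 = Real.pi / 2 * |β| := by
  rcases eq_or_ne β 0 with rfl | hβ
  · simp
  have hβ' : 0 < |β| := abs_pos.2 hβ
  have hscale : ∀ u : ℝ, (1 - Real.cos (β * u)) / u ^ 2
      = |β| ^ 2 * ((1 - Real.cos (|β| * u)) / (|β| * u) ^ 2) := fun u => by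
    have hcos : Real.cos (|β| * u) = Real.cos (β * u) := by
      rcases abs_choice β with h | h <;> simp [h]
    rw [hcos]
    field_simp
  simp_rw [hscale]
  rw [integral_const_mul, integral_comp_mul_left_Ioi (fun u => (1 - Real.cos u) / u ^ 2) 0 hβ',
    mul_zero, integral_one_sub_cos_div_sq, smul_eq_mul]
  field_simp

lemma integrableOn_one_sub_cos_mul_div_sq (β : ℝ) :
    IntegrableOn (fun u : ℝ => (1 - Real.cos (β * u)) / u ^ 2) (Ioi 0) := by
  rcases eq_or_ne β 0 with rfl | hβ
  · simp
  refine .of_integral_ne_zero ?_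
  rw [integral_one_sub_cos_mul_div_sq]
  positivity

end OneSubCos

section RieszDerivative

variable {F : Type*} [NormedAddCommGroup F] [NormedSpace ℂ F]

/-- The Riesz derivative of order `m`, that is `(-Δ)^(m/2)` on `ℝ`, except that the Fourier
multiplier is normalized to be `|b| ^ m` rather than `|2 π b| ^ m`. -/
def rieszDerivative (m : ℕ) (P : ℝ → F) : ℝ → F :=
  𝓕⁻ fun b : ℝ => |b| ^ m • 𝓕 P b

lemma rieszDerivative_eq_integral (m : ℕ) (P : ℝ → F) (x : ℝ) :
    rieszDerivative m P x = ∫ b : ℝ, 𝐞 (b * x) • |b| ^ m • 𝓕 P b := by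
  simp [rieszDerivative, Real.fourierInv_eq, mul_comm]

lemma integrable_fourierChar_smul {f : ℝ → F} (hf : Integrable f) (x : ℝ) :
    Integrable fun b : ℝ => 𝐞 (b * x) • f b := by
  simpa [mul_comm] using (Real.fourierIntegral_convergent_iff (-x)).2 hf

lemma eq_integral_fourier [CompleteSpace F] {P : ℝ → F} (hP : Continuous P) (hi : Integrable P)
    (hF : Integrable (𝓕 P)) (x : ℝ) : P x = ∫ b : ℝ, 𝐞 (b * x) • 𝓕 P b := by
  conv_lhs => rw [← hP.fourierInv_fourier_eq hi hF, Real.fourierInv_eq]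
  simp [mul_comm]

lemma fourierChar_add_fourierChar_sub (b x u : ℝ) (v : F) :
    𝐞 (b * (x + u)) • v + 𝐞 (b * (x - u)) • v - (2 : ℝ) • 𝐞 (b * x) • v
      = (-2 * (1 - Real.cos (2 * Real.pi * b * u))) • 𝐞 (b * x) • v := by
  have hadd : (𝐞 (b * u) : ℂ) + 𝐞 (-(b * u)) = (2 * Real.cos (2 * Real.pi * b * u) : ℝ) := by
    rw [Real.fourierChar_apply, Real.fourierChar_apply]
    push_cast
    rw [Complex.two_cos]
    congr 2 <;> ring
  have hfactor : 𝐞 (b * (x + u)) • v + 𝐞 (b * (x - u)) • v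
      = ((𝐞 (b * u) : ℂ) + 𝐞 (-(b * u))) • 𝐞 (b * x) • v := by
    rw [mul_add, mul_sub, sub_eq_add_neg, AddChar.map_add_eq_mul, AddChar.map_add_eq_mul,
      mul_comm, mul_comm (𝐞 (b * x)), mul_smul, mul_smul, add_smul]
    simp only [Circle.smul_def]
  rw [hfactor, hadd, Complex.coe_smul, ← sub_smul]
  congr 1
  ring

lemma integrable_abs_smul_fourierChar_smul {f : ℝ → F}
    (hf : Integrable fun b : ℝ => |b| • f b) (c : ℝ) :
    Integrable fun b : ℝ => |b| • 𝐞 (b * c) • f b := by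
  simpa only [smul_comm (𝐞 _)] using integrable_fourierChar_smul hf c

lemma integrable_one_sub_cos_div_sq_smul {f : ℝ → F} (hf : AEStronglyMeasurable f)
    (hf' : Integrable fun b : ℝ => |b| • f b) :
    Integrable
      (fun z : ℝ × ℝ => (-2 * ((1 - Real.cos (2 * Real.pi * z.1 * z.2)) / z.2 ^ 2)) • f z.1)
      (volume.prod (volume.restrict (Ioi 0))) := by
  have hmeas : Measurable fun z : ℝ × ℝ =>
      -2 * ((1 - Real.cos (2 * Real.pi * z.1 * z.2)) / z.2 ^ 2) := by fun_prop
  rw [integrable_prod_iff (hmeas.aestronglyMeasurable.fun_smul hf.comp_fst)]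
  constructor
  · exact Eventually.of_forall fun b =>
      ((integrableOn_one_sub_cos_mul_div_sq (2 * Real.pi * b)).const_mul (-2)).smul_const (f b)
  · refine (hf'.norm.const_mul (2 * Real.pi ^ 2)).congr (Eventually.of_forall fun b => ?_)
    have hnonneg : ∀ u, 0 ≤ (1 - Real.cos (2 * Real.pi * b * u)) / u ^ 2 := fun u =>
      div_nonneg (sub_nonneg.2 (Real.cos_le_one _)) (sq_nonneg u)
    simp only [norm_smul, norm_mul, norm_neg, Real.norm_ofNat, Real.norm_eq_abs, abs_abs,
      abs_of_nonneg (hnonneg _)]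
    rw [integral_mul_const, integral_const_mul, integral_one_sub_cos_mul_div_sq, abs_mul,
      abs_of_pos Real.two_pi_pos]
    ring

variable [CompleteSpace F] {P : ℝ → F}

lemma second_difference_eq_integral (hP : Continuous P) (hi : Integrable P)
    (hF : Integrable (𝓕 P)) (c u : ℝ) :
    P (c + u) + P (c - u) - (2 : ℝ) • P c
      = ∫ b : ℝ, (-2 * (1 - Real.cos (2 * Real.pi * b * u))) • 𝐞 (b * c) • 𝓕 P b := by
  have hint : ∀ x, Integrable fun b : ℝ => 𝐞 (b * x) • 𝓕 P b := integrable_fourierChar_smul hF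
  simp only [eq_integral_fourier hP hi hF (c + u), eq_integral_fourier hP hi hF (c - u),
    eq_integral_fourier hP hi hF c, ← fourierChar_add_fourierChar_sub]
  rw [integral_sub (by exact (hint _).add (hint _)) (by exact (hint c).smul (2 : ℝ)),
    integral_add (hint _) (hint _), integral_smul]

lemma second_difference_div_sq_eq_integral (hP : Continuous P) (hi : Integrable P)
    (hF : Integrable (𝓕 P)) (c u : ℝ) :
    (u ^ 2)⁻¹ • (P (c + u) + P (c - u) - (2 : ℝ) • P c)
      = ∫ b : ℝ, (-2 * ((1 - Real.cos (2 * Real.pi * b * u)) / u ^ 2)) • 𝐞 (b * c) • 𝓕 P b := by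
  rw [second_difference_eq_integral hP hi hF, ← integral_smul]
  congr with b
  rw [smul_smul]
  congr 1
  ring

lemma integrableOn_second_difference_div_sq (hP : Continuous P) (hi : Integrable P)
    (hF : Integrable (𝓕 P)) (hF' : Integrable fun b : ℝ => |b| • 𝓕 P b) (c : ℝ) :
    IntegrableOn (fun u : ℝ => (u ^ 2)⁻¹ • (P (c + u) + P (c - u) - (2 : ℝ) • P c)) (Ioi 0) := by
  simp_rw [second_difference_div_sq_eq_integral hP hi hF]
  exact (integrable_one_sub_cos_div_sq_smul
    (integrable_fourierChar_smul hF c).aestronglyMeasurable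
    (integrable_abs_smul_fourierChar_smul hF' c)).integral_prod_right

lemma integral_second_difference_div_sq (hP : Continuous P) (hi : Integrable P)
    (hF : Integrable (𝓕 P)) (hF' : Integrable fun b : ℝ => |b| • 𝓕 P b) (c : ℝ) :
    ∫ u in Ioi (0 : ℝ), (u ^ 2)⁻¹ • (P (c + u) + P (c - u) - (2 : ℝ) • P c)
      = -(2 * Real.pi ^ 2) • rieszDerivative 1 P c := by
  simp_rw [second_difference_div_sq_eq_integral hP hi hF]
  rw [← integral_integral_swap (integrable_one_sub_cos_div_sq_smul
    (integrable_fourierChar_smul hF c).aestronglyMeasurable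
    (integrable_abs_smul_fourierChar_smul hF' c)), rieszDerivative_eq_integral, ← integral_smul]
  congr with b
  rw [integral_smul_const, integral_const_mul, integral_one_sub_cos_mul_div_sq, abs_mul,
    abs_of_pos Real.two_pi_pos, pow_one, smul_comm (𝐞 _), smul_smul]
  congr 1
  ring

end RieszDerivative

section FinitePart

variable {F : Type*} [NormedAddCommGroup F]

lemma integrableOn_inv_sq_smul [NormedSpace ℝ F] {P : ℝ → F} (hP : Integrable P) (c : ℝ) {ε : ℝ}
    (hε : 0 < ε) : IntegrableOn (fun s => ((c - s) ^ 2)⁻¹ • P s) {s | ε < |c - s|} := by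
  refine hP.integrableOn.bdd_smul (ε ^ 2)⁻¹ (Measurable.aestronglyMeasurable (by fun_prop)) ?_
  filter_upwards [ae_restrict_mem (measurableSet_lt measurable_const (by fun_prop))]
    with s (hs : ε < |c - s|)
  rw [norm_inv, norm_pow, Real.norm_eq_abs]
  gcongr

lemma setIntegral_lt_abs_sub [NormedSpace ℝ F] {Q : ℝ → F} {c ε : ℝ} (hε : 0 < ε)
    (hQ : IntegrableOn Q {s | ε < |c - s|}) :
    ∫ s in {s | ε < |c - s|}, Q s = ∫ u in Ioi ε, (Q (c + u) + Q (c - u)) := by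
  have hset : {s | ε < |c - s|} = Ioi (c + ε) ∪ Iio (c - ε) := by
    ext s
    rw [mem_ofPred_eq, lt_abs, mem_union, mem_Ioi, mem_Iio, or_comm, neg_sub, lt_sub_iff_add_lt',
      lt_sub_comm]
  rw [hset, integrableOn_union] at hQ
  have hright := measurePreserving_add_left volume c
  have hright_emb := (MeasurableEquiv.addLeft c).measurableEmbedding
  have hright_int := (hright.integrableOn_comp_preimage hright_emb).2 hQ.1
  have hright_eq := hright.setIntegral_preimage_emb hright_emb Q (Ioi (c + ε))
  have hleft := volume.measurePreserving_sub_left c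
  have hleft_emb := (MeasurableEquiv.subLeft c).measurableEmbedding
  have hleft_int := (hleft.integrableOn_comp_preimage hleft_emb).2 hQ.2
  have hleft_eq := hleft.setIntegral_preimage_emb hleft_emb Q (Iio (c - ε))
  simp only [preimage_const_add_Ioi, add_sub_cancel_left] at hright_int hright_eq
  simp only [preimage_const_sub_Iio, sub_sub_cancel] at hleft_int hleft_eq
  rw [hset, setIntegral_union (Ioi_disjoint_Iio_of_le (by linarith)) measurableSet_Iio hQ.1 hQ.2,
    ← hright_eq, ← hleft_eq]
  exact (integral_add hright_int hleft_int).symm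

lemma integral_Ioi_inv_sq {ε : ℝ} (hε : 0 < ε) : ∫ u in Ioi ε, (u ^ 2)⁻¹ = ε⁻¹ := by
  have h := integral_Ioi_rpow_of_lt (a := -2) (by norm_num) hε
  norm_num [Real.rpow_neg_one] at h
  exact h

/-- The divergent term is `2 P c / ε`: subtract `2 P c` from `P (c + u) + P (c - u)`. -/
lemma tendsto_finitePart_inv_sq [NormedSpace ℂ F] [CompleteSpace F] {P : ℝ → F}
    (hP : Continuous P) (hi : Integrable P) (hF : Integrable (𝓕 P))
    (hF' : Integrable fun b : ℝ => |b| • 𝓕 P b) (c : ℝ) :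
    Tendsto (fun ε : ℝ => (∫ s in {s | ε < |c - s|}, ((c - s) ^ 2)⁻¹ • P s) - (2 / ε) • P c)
      (𝓝[>] 0) (𝓝 (-(2 * Real.pi ^ 2) • rieszDerivative 1 P c)) := by
  have hint := integrableOn_second_difference_div_sq hP hi hF hF' c
  have hcover : AECover (volume.restrict (Ioi (0 : ℝ))) (𝓝[>] 0) fun ε : ℝ => Ioi ε :=
    aecover_Ioi_of_Ioi (tendsto_id.mono_left nhdsWithin_le_nhds)
  rw [← integral_second_difference_div_sq hP hi hF hF']
  refine (hcover.integral_tendsto_of_countably_generated hint).congr' ?_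
  filter_upwards [self_mem_nhdsWithin] with ε (hε : 0 < ε)
  have hdiv : ∫ u in Ioi ε, (u ^ 2)⁻¹ • (2 : ℝ) • P c = (2 / ε) • P c := by
    rw [integral_smul_const, integral_Ioi_inv_sq hε, smul_smul, div_eq_inv_mul]
  have hdiv_int : IntegrableOn (fun u : ℝ => (u ^ 2)⁻¹ • (2 : ℝ) • P c) (Ioi ε) :=
    (Integrable.of_integral_ne_zero
      (by rw [integral_Ioi_inv_sq hε]; positivity)).smul_const _
  rw [Measure.restrict_restrict measurableSet_Ioi, inter_eq_left.2 (Ioi_subset_Ioi hε.le),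
    setIntegral_lt_abs_sub hε (integrableOn_inv_sq_smul hi c hε), ← hdiv, eq_sub_iff_add_eq,
    ← integral_add (hint.mono_set (Ioi_subset_Ioi hε.le)) hdiv_int]
  congr with u
  simp [smul_sub, smul_add]

end FinitePart

/-! ### Image densities -/

section Substitution

variable {F : Type*} [NormedAddCommGroup F] [NormedSpace ℝ F]

lemma integral_Ioi_comp_sq (m : ℝ → F) :
    ∫ τ in Ioi (0 : ℝ), (2 * τ) • m (τ ^ 2) = ∫ s in Ioi (0 : ℝ), m s := by
  rw [← integral_comp_rpow_Ioi_of_pos (g := m) two_pos]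
  norm_num

lemma integrableOn_Ioi_comp_sq {m : ℝ → F} (hm : IntegrableOn m (Ioi 0)) :
    IntegrableOn (fun τ : ℝ => (2 * τ) • m (τ ^ 2)) (Ioi 0) := by
  have h := (integrableOn_Ioi_comp_rpow_iff m two_ne_zero).2 hm
  norm_num at h
  exact h

lemma setIntegral_Ioi_eq_integral {m : ℝ → F} (hm : ∀ s ≤ 0, m s = 0) :
    ∫ s in Ioi (0 : ℝ), m s = ∫ s, m s :=
  setIntegral_eq_integral_of_forall_compl_eq_zero fun s hs => hm s (not_lt.1 hs)

lemma integral_eq_integral_Ioi_sqrt_of_even {g : ℝ → F} (hg : Integrable g)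
    (heven : Function.Even g) :
    ∫ s, g s = ∫ v in Ioi (0 : ℝ), (√v)⁻¹ • g √v := by
  have hneg : ∫ s in Iic (0 : ℝ), g s = ∫ s in Ioi (0 : ℝ), g s := by
    simpa only [heven _, neg_zero] using integral_comp_neg_Iic (0 : ℝ) g
  rw [← intervalIntegral.integral_Iic_add_Ioi hg.integrableOn hg.integrableOn, hneg, ← two_smul ℝ,
    ← integral_smul, ← integral_Ioi_comp_sq fun v => (√v)⁻¹ • g √v]
  refine setIntegral_congr_fun measurableSet_Ioi fun τ (hτ : 0 < τ) => ?_
  rw [Real.sqrt_sq hτ.le, smul_smul, mul_assoc, mul_inv_cancel₀ hτ.ne', mul_one]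

lemma tendsto_symmetric_mean [CompleteSpace F] {r : ℝ → F} (hr : Continuous r) (t : ℝ) :
    Tendsto (fun ε : ℝ => (2 * ε)⁻¹ • ∫ τ in Ioo (t - ε) (t + ε), r τ) (𝓝[>] 0) (𝓝 (r t)) := by
  have hprim : ∀ x, HasDerivAt (fun x => ∫ τ in (0 : ℝ)..x, r τ) (r x) x := fun x =>
    intervalIntegral.integral_hasDerivAt_right (hr.intervalIntegrable _ _)
      (hr.stronglyMeasurableAtFilter _ _) hr.continuousAt
  have hright : HasDerivAt (fun ε : ℝ => t + ε) 1 0 := (hasDerivAt_id (0 : ℝ)).const_add t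
  have hleft : HasDerivAt (fun ε : ℝ => t - ε) (-1) 0 := (hasDerivAt_id (0 : ℝ)).const_sub t
  have hslope := ((((hprim (t + 0)).scomp 0 hright).sub
    ((hprim (t - 0)).scomp 0 hleft)).tendsto_slope_zero_right).const_smul (2⁻¹ : ℝ)
  have hlim : (2⁻¹ : ℝ) • ((1 : ℝ) • r (t + 0) - (-1 : ℝ) • r (t - 0)) = r t := by
    rw [add_zero, sub_zero]
    module
  rw [hlim] at hslope
  refine hslope.congr' ?_
  filter_upwards [self_mem_nhdsWithin] with ε (hε : 0 < ε)
  simp only [Pi.sub_apply, Function.comp_apply, zero_add, add_zero, sub_zero, sub_self]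
  rw [intervalIntegral.integral_interval_sub_left (hr.intervalIntegrable _ _)
    (hr.intervalIntegrable _ _), intervalIntegral.integral_of_le (by linarith),
    integral_Ioc_eq_integral_Ioo, smul_smul, mul_inv]

end Substitution

section ImageDensity

variable {X : Type*} [MeasurableSpace X] {F : Type*} [NormedAddCommGroup F] [NormedSpace ℂ F]
  {μ : Measure X} {φ : X → ℝ} {f : X → F} {r : ℝ → F}

/-- The image under `φ` of the vector measure `f μ` has density `r` with respect to Lebesgue
measure on `ℝ`. This is expressed by testing against bounded measurable functions; the integrals
take the junk value `0` when `f` or `r` is not integrable. -/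
def HasImageDensity (μ : Measure X) (φ : X → ℝ) (f : X → F) (r : ℝ → F) : Prop :=
  ∀ k : ℝ → ℂ, Measurable k → (∃ M, ∀ s, ‖k s‖ ≤ M) → ∫ x, k (φ x) • f x ∂μ = ∫ s, k s • r s

namespace HasImageDensity

lemma fourier_eq (h : HasImageDensity μ φ f r) (b : ℝ) :
    𝓕 r b = ∫ x, 𝐞 (-(φ x * b)) • f x ∂μ := by
  rw [Real.fourier_real_eq]
  exact (h (fun s => 𝐞 (-(s * b))) (by fun_prop) ⟨1, fun s => (Circle.norm_coe _).le⟩).symm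

lemma setIntegral_smul_eq (h : HasImageDensity μ φ f r) (hφ : Measurable φ) {S : Set ℝ}
    (hS : MeasurableSet S) {k : ℝ → ℝ} (hk : Measurable k) {M : ℝ} (hM : ∀ s ∈ S, |k s| ≤ M) :
    ∫ x in φ ⁻¹' S, k (φ x) • f x ∂μ = ∫ s in S, k s • r s := by
  have hbound : ∀ s, ‖S.indicator (fun s => (k s : ℂ)) s‖ ≤ max M 0 := fun s => by
    by_cases hs : s ∈ S <;> simp [hs, hM]
  have hmeas : Measurable (S.indicator fun s => (k s : ℂ)) := Measurable.indicator (by fun_prop) hS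
  rw [← integral_indicator (hφ hS), ← integral_indicator hS]
  refine Eq.trans ?_ ((h _ hmeas ⟨_, hbound⟩).trans ?_)
  · congr with x
    by_cases hx : φ x ∈ S <;> simp [hx]
  · congr with s
    by_cases hs : s ∈ S <;> simp [hs]

lemma setIntegral_eq (h : HasImageDensity μ φ f r) (hφ : Measurable φ) {S : Set ℝ}
    (hS : MeasurableSet S) : ∫ x in φ ⁻¹' S, f x ∂μ = ∫ s in S, r s := by
  simpa using h.setIntegral_smul_eq hφ hS measurable_const (fun s _ => abs_one.le)

lemma of_sq {ρ : X → ℝ} (h : HasImageDensity μ (fun x => ρ x ^ 2) f r) (hρ : ∀ x, 0 ≤ ρ x)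
    (hr : ∀ s ≤ 0, r s = 0) :
    HasImageDensity μ ρ f fun t => (2 * max t 0) • r (t ^ 2) := by
  rintro k hk ⟨M, hM⟩
  have hsqrt := h (fun s => k √s) (by fun_prop) ⟨M, fun s => hM _⟩
  simp only [Real.sqrt_sq (hρ _)] at hsqrt
  rw [hsqrt, ← setIntegral_Ioi_eq_integral fun s hs => by rw [hr s hs, smul_zero],
    ← integral_Ioi_comp_sq,
    ← setIntegral_Ioi_eq_integral fun t ht => by simp [max_eq_right ht]]
  refine setIntegral_congr_fun measurableSet_Ioi fun t (ht : 0 < t) => ?_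
  simp only [Real.sqrt_sq ht.le, max_eq_left ht.le]
  rw [smul_comm]

lemma hasDeltaIntegral {E : Type*} [MeasureSpace E] {φ : E → ℝ} {f : E → ℂ} {r : ℝ → ℂ}
    (h : HasImageDensity volume φ f r) (hφ : Measurable φ) (hr : Continuous r) (t : ℝ) :
    HasDeltaIntegral φ t f (r t) := by
  refine (tendsto_symmetric_mean hr t).congr fun ε => ?_
  rw [← h.setIntegral_eq hφ measurableSet_Ioo, ← Real.ball_eq_Ioo]
  rfl

end HasImageDensity

lemma hasImageDensity_sq {h r : ℝ → F} (hr : ∀ s ≤ 0, r s = 0)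
    (hh : ∀ τ > 0, h τ = (2 * τ) • r (τ ^ 2)) :
    HasImageDensity (volume.restrict (Ioi 0)) (fun τ : ℝ => τ ^ 2) h r := by
  intro k _ _
  rw [← setIntegral_Ioi_eq_integral fun s hs => by rw [hr s hs, smul_zero],
    ← integral_Ioi_comp_sq fun s => k s • r s]
  refine setIntegral_congr_fun measurableSet_Ioi fun τ hτ => ?_
  simp only [hh τ hτ, smul_comm (k _)]

end ImageDensity

/-! ### Integrals over paraboloids -/

section SchwartzLine

variable {V F : Type*} [NormedAddCommGroup V] [NormedSpace ℝ V] [NormedAddCommGroup F]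
  [NormedSpace ℝ F]

lemma integrable_pow_smul_comp_smul (Φ : SchwartzMap V F) {v : V} (hv : v ≠ 0) (m : ℕ) :
    Integrable fun b : ℝ => |b| ^ m • Φ (b • v) := by
  obtain ⟨K, -, hK⟩ := (LinearMap.toSpanSingleton ℝ V v).exists_antilipschitzWith
    (LinearMap.ker_toSpanSingleton ℝ hv)
  let Ψ : SchwartzMap ℝ F := SchwartzMap.compCLMOfAntilipschitz ℝ
    (ContinuousLinearMap.toSpanSingleton ℝ v).hasTemperateGrowth hK Φ
  have hΨ : ∀ b, Ψ b = Φ (b • v) := fun b => rfl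
  simp only [← hΨ]
  refine (Ψ.integrable_pow_mul volume m).mono' (Continuous.aestronglyMeasurable (by fun_prop))
    (Eventually.of_forall fun b => ?_)
  rw [norm_smul, norm_pow, Real.norm_eq_abs, Real.norm_eq_abs, abs_abs]

end SchwartzLine

section Dilation

variable {E : Type*} [NormedAddCommGroup E] [NormedSpace ℝ E] [FiniteDimensional ℝ E]
  [MeasurableSpace E] [BorelSpace E] {μ : Measure E} [μ.IsAddHaarMeasure]
  {F : Type*} [NormedAddCommGroup F] [NormedSpace ℝ F] {Φ : E × ℝ → F} {c : ℝ}

lemma abs_pow_mul_abs_inv_mul_pow {b : ℝ} (hb : b ≠ 0) (d : ℕ) :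
    |b| ^ d * |((c * b) ^ d)⁻¹| = (|c| ^ d)⁻¹ := by
  have : |b| ≠ 0 := abs_ne_zero.2 hb
  rw [abs_inv, abs_pow, abs_mul, mul_pow]
  field_simp

lemma integrable_abs_pow_smul_comp_dilation (hΦ : StronglyMeasurable Φ)
    (hi : Integrable Φ (μ.prod volume)) (hc : c ≠ 0) :
    Integrable (fun z : E × ℝ => |z.2| ^ Module.finrank ℝ E • Φ ((c * z.2) • z.1, z.2))
      (μ.prod volume) := by
  have hmeas : Measurable fun z : E × ℝ => ((c * z.2) • z.1, z.2) := by fun_prop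
  have hpow : Continuous fun z : E × ℝ => |z.2| ^ Module.finrank ℝ E := by fun_prop
  rw [integrable_prod_iff' (f := fun z => |z.2| ^ Module.finrank ℝ E • Φ ((c * z.2) • z.1, z.2))
    (hpow.stronglyMeasurable.smul (hΦ.comp_measurable hmeas)).aestronglyMeasurable]
  constructor
  · filter_upwards [hi.prod_left_ae, Measure.ae_ne volume 0] with b hb hb0
    exact (hb.comp_smul (mul_ne_zero hc hb0)).smul _
  · refine (hi.norm.integral_prod_right.const_mul (|c| ^ Module.finrank ℝ E)⁻¹).congr ?_
    filter_upwards [Measure.ae_ne volume 0] with b hb0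
    simp_rw [norm_smul, norm_pow, Real.norm_eq_abs, abs_abs]
    rw [integral_const_mul, Measure.integral_comp_smul μ (fun y => ‖Φ (y, b)‖), smul_eq_mul,
      ← mul_assoc, abs_pow_mul_abs_inv_mul_pow hb0]

lemma integral_abs_pow_smul_comp_dilation (hΦ : StronglyMeasurable Φ)
    (hi : Integrable Φ (μ.prod volume)) (hc : c ≠ 0) :
    ∫ y, (∫ b : ℝ, |b| ^ Module.finrank ℝ E • Φ ((c * b) • y, b)) ∂μ
      = (|c| ^ Module.finrank ℝ E)⁻¹ • ∫ z, Φ z ∂μ.prod volume := by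
  rw [integral_integral_swap (integrable_abs_pow_smul_comp_dilation hΦ hi hc),
    integral_prod_symm _ hi, ← integral_smul]
  refine integral_congr_ae ?_
  filter_upwards [Measure.ae_ne volume 0] with b hb0
  rw [integral_smul, Measure.integral_comp_smul μ (fun y => Φ (y, b)), smul_smul,
    abs_pow_mul_abs_inv_mul_pow hb0]

end Dilation

section Paraboloid

variable {E : Type*} [NormedAddCommGroup E] [InnerProductSpace ℝ E]

/-- The shear `(y, s) ↦ (y, s - ‖y - α‖²)`, which maps the hyperplanes `s = const` to paraboloids
with vertex above `α`. -/
def paraboloidShear (α : E) : E × ℝ ≃ₜ E × ℝ where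
  toFun z := (z.1, z.2 - ‖z.1 - α‖ ^ 2)
  invFun z := (z.1, z.2 + ‖z.1 - α‖ ^ 2)
  left_inv z := by simp
  right_inv z := by simp
  continuous_toFun := by fun_prop
  continuous_invFun := by fun_prop

variable {F : Type*} [NormedAddCommGroup F]

/-- `G` composed with the shear that straightens the paraboloids with vertex above `0`, as a
function on the Euclidean product, where the Fourier transform is available. -/
def paraboloidLift (G : E × ℝ → F) (w : WithLp 2 (E × ℝ)) : F :=
  G (paraboloidShear 0 w.ofLp)

lemma contDiff_paraboloidLift [NormedSpace ℝ F] {G : E × ℝ → F} (hG : ContDiff ℝ ∞ G) :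
    ContDiff ℝ ∞ (paraboloidLift G) := by
  have hshear : ContDiff ℝ ∞ (paraboloidShear (0 : E)) :=
    contDiff_fst.prodMk (contDiff_snd.sub ((contDiff_fst.sub contDiff_const).norm_sq ℝ))
  exact (hG.comp hshear).comp (WithLp.prodContinuousLinearEquiv 2 ℝ E ℝ).contDiff

lemma hasCompactSupport_paraboloidLift {G : E × ℝ → F} (hc : HasCompactSupport G) :
    HasCompactSupport (paraboloidLift G) :=
  hc.comp_homeomorph
    ((WithLp.prodContinuousLinearEquiv 2 ℝ E ℝ).toHomeomorph.trans (paraboloidShear (0 : E)))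

variable [FiniteDimensional ℝ E] [MeasurableSpace E] [BorelSpace E] {G : E × ℝ → F}

lemma measurePreserving_paraboloidShear (α : E) : MeasurePreserving (paraboloidShear α) :=
  (MeasurePreserving.id volume).skew_product (g := fun (y : E) (s : ℝ) => s - ‖y - α‖ ^ 2)
    (by unfold Function.uncurry; fun_prop)
    (Eventually.of_forall fun y => (measurePreserving_sub_right volume _).map_eq)

variable [NormedSpace ℂ F]

/-- The integral of `G` over the paraboloid `{(y, s - ‖y - α‖²)}`, with respect to `dy`. -/
def paraboloidIntegral (G : E × ℝ → F) (α : E) (s : ℝ) : F :=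
  ∫ y, G (y, s - ‖y - α‖ ^ 2)

lemma hasImageDensity_paraboloidIntegral (hG : Integrable G) (α : E) :
    HasImageDensity volume (fun z : E × ℝ => z.2 + ‖z.1 - α‖ ^ 2) G (paraboloidIntegral G α) := by
  rintro k hk ⟨M, hM⟩
  have hmp := measurePreserving_paraboloidShear α
  have hemb := (paraboloidShear α).measurableEmbedding
  have hint : Integrable fun z : E × ℝ => k z.2 • G (paraboloidShear α z) :=
    ((hmp.integrable_comp_emb hemb).2 hG).bdd_smul M
      (hk.comp measurable_snd).aestronglyMeasurable (Eventually.of_forall fun z => hM z.2)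
  calc ∫ z : E × ℝ, k (z.2 + ‖z.1 - α‖ ^ 2) • G z
      = ∫ z : E × ℝ, k z.2 • G (paraboloidShear α z) := by
        rw [← hmp.integral_comp hemb]
        simp [paraboloidShear]
    _ = ∫ s, ∫ y, k s • G (y, s - ‖y - α‖ ^ 2) := integral_prod_symm _ hint
    _ = ∫ s, k s • paraboloidIntegral G α s := by
        simp only [integral_smul, paraboloidIntegral]

lemma integrable_paraboloidIntegral (hG : Integrable G) (α : E) :
    Integrable (paraboloidIntegral G α) :=
  ((measurePreserving_paraboloidShear α).integrable_comp_emb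
    (paraboloidShear α).measurableEmbedding).2 hG |>.integral_prod_right

lemma continuous_paraboloidIntegral (hG : Continuous G) (hc : HasCompactSupport G) (α : E) :
    Continuous (paraboloidIntegral G α) := by
  have hsupport : ∀ s, ∀ y ∉ Prod.fst '' tsupport G, G (y, s - ‖y - α‖ ^ 2) = 0 :=
    fun s y hy => by_contra fun hne => hy ⟨_, subset_tsupport G hne, rfl⟩
  have hrestrict : paraboloidIntegral G α
      = fun s => ∫ y in Prod.fst '' tsupport G, G (y, s - ‖y - α‖ ^ 2) :=
    funext fun s => (setIntegral_eq_integral_of_forall_compl_eq_zero (hsupport s)).symm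
  rw [hrestrict]
  exact continuous_parametric_integral_of_continuous (by unfold Function.uncurry; fun_prop)
    (hc.image continuous_fst)

lemma fourier_paraboloidLift (G : E × ℝ → F) (η : E) (b : ℝ) :
    𝓕 (paraboloidLift G) (WithLp.toLp 2 (η, b))
      = ∫ z : E × ℝ, 𝐞 (-(⟪z.1, η⟫ + (z.2 + ‖z.1‖ ^ 2) * b)) • G z := by
  rw [Real.fourier_eq, ← (WithLp.volume_preserving_toLp E ℝ).integral_comp
    (MeasurableEquiv.toLp 2 (E × ℝ)).measurableEmbedding,
    ← (measurePreserving_paraboloidShear (0 : E)).integral_comp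
      (paraboloidShear 0).measurableEmbedding fun z : E × ℝ =>
        𝐞 (-(⟪z.1, η⟫ + (z.2 + ‖z.1‖ ^ 2) * b)) • G z]
  congr with z
  simp [paraboloidLift, paraboloidShear, WithLp.prod_inner_apply, mul_comm]

lemma fourier_paraboloidIntegral (hG : Integrable G) (α : E) (b : ℝ) :
    𝓕 (paraboloidIntegral G α) b
      = 𝐞 (-(‖α‖ ^ 2 * b)) • 𝓕 (paraboloidLift G) (WithLp.toLp 2 ((-2 * b) • α, b)) := by
  rw [(hasImageDensity_paraboloidIntegral hG α).fourier_eq, fourier_paraboloidLift,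
    Circle.smul_def, ← integral_smul]
  congr with z
  rw [← Circle.smul_def, smul_smul, ← AddChar.map_add_eq_mul, norm_sub_sq_real,
    real_inner_smul_right]
  congr 2
  ring

lemma integrable_pow_smul_fourier_paraboloidIntegral (hG : ContDiff ℝ ∞ G)
    (hc : HasCompactSupport G) (m : ℕ) (α : E) :
    Integrable fun b : ℝ => |b| ^ m • 𝓕 (paraboloidIntegral G α) b := by
  let Φ : SchwartzMap (WithLp 2 (E × ℝ)) F :=
    𝓕 ((hasCompactSupport_paraboloidLift hc).toSchwartzMap (contDiff_paraboloidLift hG))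
  have hv : WithLp.toLp 2 ((-2 : ℝ) • α, (1 : ℝ)) ≠ 0 := fun h =>
    one_ne_zero (congrArg WithLp.snd h)
  refine (integrable_fourierChar_smul (integrable_pow_smul_comp_smul Φ hv m) (-(‖α‖ ^ 2))).congr
    (Eventually.of_forall fun b => ?_)
  have hline : b • WithLp.toLp 2 ((-2 : ℝ) • α, (1 : ℝ)) = WithLp.toLp 2 ((-2 * b) • α, b) := by
    rw [← WithLp.toLp_smul, Prod.smul_mk, smul_smul, smul_eq_mul, mul_one, mul_comm]
  simp only [hline]
  rw [fourier_paraboloidIntegral (hG.continuous.integrable_of_hasCompactSupport hc), smul_comm,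
    mul_neg, mul_comm b]
  rfl

/-- The integrand of Fourier inversion at `w`, in the coordinates of the product. -/
def fourierInvIntegrand (f : WithLp 2 (E × ℝ) → F) (w : WithLp 2 (E × ℝ)) (z : E × ℝ) : F :=
  𝐞 ⟪WithLp.toLp 2 z, w⟫ • 𝓕 f (WithLp.toLp 2 z)

lemma continuous_fourierInvIntegrand {f : WithLp 2 (E × ℝ) → F} (hF : Continuous (𝓕 f))
    (w : WithLp 2 (E × ℝ)) : Continuous (fourierInvIntegrand f w) := by
  have htoLp := WithLp.prod_continuous_toLp 2 E ℝ
  exact (Real.continuous_fourierChar.comp (htoLp.inner continuous_const)).smul (hF.comp htoLp)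

lemma integrable_fourierInvIntegrand {f : WithLp 2 (E × ℝ) → F} (hF : Continuous (𝓕 f))
    (hFi : Integrable (𝓕 f)) (w : WithLp 2 (E × ℝ)) : Integrable (fourierInvIntegrand f w) := by
  have h := ((WithLp.volume_preserving_toLp E ℝ).integrable_comp_emb
    (MeasurableEquiv.toLp 2 (E × ℝ)).measurableEmbedding).2 hFi
  exact h.mono (continuous_fourierInvIntegrand hF w).aestronglyMeasurable
    (Eventually.of_forall fun z => (Circle.norm_smul _ _).le)

lemma integral_fourierInvIntegrand [CompleteSpace F] {f : WithLp 2 (E × ℝ) → F} (hf : Continuous f)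
    (hi : Integrable f) (hF : Integrable (𝓕 f)) (w : WithLp 2 (E × ℝ)) :
    ∫ z, fourierInvIntegrand f w z = f w := by
  simp only [fourierInvIntegrand]
  rw [(WithLp.volume_preserving_toLp E ℝ).integral_comp
    (MeasurableEquiv.toLp 2 (E × ℝ)).measurableEmbedding fun v => 𝐞 ⟪v, w⟫ • 𝓕 f v,
    ← Real.fourierInv_eq, hf.fourierInv_fourier_eq hi hF]

lemma rieszDerivative_paraboloidIntegral (hG : Integrable G) (m : ℕ) (α p : E) (q : ℝ) :
    rieszDerivative m (paraboloidIntegral G α) (‖α - p‖ ^ 2 + q)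
      = ∫ b : ℝ, |b| ^ m • fourierInvIntegrand (paraboloidLift G)
          (WithLp.toLp 2 (p, ‖p‖ ^ 2 + q)) ((-2 * b) • α, b) := by
  rw [rieszDerivative_eq_integral]
  congr with b
  rw [smul_comm, fourier_paraboloidIntegral hG, fourierInvIntegrand, smul_smul,
    ← AddChar.map_add_eq_mul, WithLp.prod_inner_apply, norm_sub_sq_real]
  congr 3
  simp only [real_inner_smul_left, RCLike.inner_apply, conj_trivial]
  ring

lemma integrable_rieszDerivative_paraboloidIntegral (hG : ContDiff ℝ ∞ G)
    (hc : HasCompactSupport G) (p : E) (q : ℝ) :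
    Integrable fun α => rieszDerivative (Module.finrank ℝ E) (paraboloidIntegral G α)
      (‖α - p‖ ^ 2 + q) := by
  let Φ : SchwartzMap (WithLp 2 (E × ℝ)) F :=
    𝓕 ((hasCompactSupport_paraboloidLift hc).toSchwartzMap (contDiff_paraboloidLift hG))
  have hcont := continuous_fourierInvIntegrand (f := paraboloidLift G) Φ.continuous
    (WithLp.toLp 2 (p, ‖p‖ ^ 2 + q))
  simp_rw [rieszDerivative_paraboloidIntegral (hG.continuous.integrable_of_hasCompactSupport hc)]
  exact (integrable_abs_pow_smul_comp_dilation hcont.stronglyMeasurable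
    (integrable_fourierInvIntegrand Φ.continuous Φ.integrable _)
    (neg_ne_zero.2 two_ne_zero)).integral_prod_left

lemma integral_rieszDerivative_paraboloidIntegral [CompleteSpace F] (hG : ContDiff ℝ ∞ G)
    (hc : HasCompactSupport G) (p : E) (q : ℝ) :
    ∫ α, rieszDerivative (Module.finrank ℝ E) (paraboloidIntegral G α) (‖α - p‖ ^ 2 + q)
      = ((2 : ℝ) ^ Module.finrank ℝ E)⁻¹ • G (p, q) := by
  let lift := (hasCompactSupport_paraboloidLift hc).toSchwartzMap (contDiff_paraboloidLift hG)
  have hcont := continuous_fourierInvIntegrand (f := paraboloidLift G) (𝓕 lift).continuous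
    (WithLp.toLp 2 (p, ‖p‖ ^ 2 + q))
  simp_rw [rieszDerivative_paraboloidIntegral (hG.continuous.integrable_of_hasCompactSupport hc)]
  rw [integral_abs_pow_smul_comp_dilation hcont.stronglyMeasurable
    (integrable_fourierInvIntegrand (𝓕 lift).continuous (𝓕 lift).integrable _)
    (neg_ne_zero.2 two_ne_zero), ← Measure.volume_eq_prod,
    integral_fourierInvIntegrand (f := paraboloidLift G)
      lift.continuous lift.integrable (𝓕 lift).integrable, abs_neg, abs_two]
  simp [paraboloidLift, paraboloidShear]

end Paraboloid

/-! ### The operator `Λ` and the finite part in terms of the Riesz derivative -/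

section Lambda

variable {h P : ℝ → ℂ} (hP : HasImageDensity (volume.restrict (Ioi 0)) (fun τ : ℝ => τ ^ 2) h P)

include hP

lemma integral_LambdaIntegrand (m : ℕ) (t β : ℝ) :
    ∫ τ in Ioi (0 : ℝ), LambdaIntegrand (m + 1) h t β τ
      = (2 * Real.pi) ^ m • 𝐞 ((2 * Real.pi)⁻¹ * β * t ^ 2) •
        |(2 * Real.pi)⁻¹ * β| ^ m • 𝓕 P ((2 * Real.pi)⁻¹ * β) := by
  rw [hP.fourier_eq, Circle.smul_def, ← integral_smul, ← integral_smul, ← integral_smul]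
  congr with τ
  have hpow : (2 * Real.pi) ^ m * |(2 * Real.pi)⁻¹ * β| ^ m = |β| ^ m := by
    rw [abs_mul, abs_inv, abs_of_pos Real.two_pi_pos, ← mul_pow,
      mul_inv_cancel_left₀ Real.two_pi_pos.ne']
  have hexp : Complex.exp (Complex.I * ((t ^ 2 - τ ^ 2) * β : ℝ))
      = 𝐞 ((2 * Real.pi)⁻¹ * β * t ^ 2) * 𝐞 (-(τ ^ 2 * ((2 * Real.pi)⁻¹ * β))) := by
    rw [← Circle.coe_mul, ← AddChar.map_add_eq_mul, Real.fourierChar_apply, mul_comm Complex.I]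
    congr 3
    field_simp
    ring
  rw [LambdaIntegrand, add_tsub_cancel_right, hexp, ← hpow]
  simp only [Circle.smul_def, Complex.real_smul, smul_eq_mul, Complex.ofReal_mul]
  ring

lemma lambdaConverges (hh : IntegrableOn h (Ioi 0)) {m : ℕ}
    (hF : Integrable fun b : ℝ => |b| ^ m • 𝓕 P b) (t : ℝ) : LambdaConverges (m + 1) h t := by
  refine ⟨fun β => hh.bdd_mul (c := |β| ^ m)
    (Continuous.aestronglyMeasurable (by fun_prop)) (Eventually.of_forall fun τ => ?_), ?_⟩
  · rw [norm_mul, mul_comm Complex.I, Complex.norm_exp_ofReal_mul_I, one_mul,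
      Complex.norm_real, Real.norm_of_nonneg (by positivity), add_tsub_cancel_right]
  · simp_rw [integral_LambdaIntegrand hP]
    exact ((integrable_fourierChar_smul hF (t ^ 2)).comp_mul_left'
      (inv_ne_zero Real.two_pi_pos.ne')).smul ((2 * Real.pi) ^ m)

lemma Lambda_eq_rieszDerivative (m : ℕ) (t : ℝ) :
    Lambda (m + 1) h t = (2 * Real.pi) ^ (m + 1) • rieszDerivative m P (t ^ 2) := by
  simp_rw [Lambda, integral_LambdaIntegrand hP]
  rw [integral_smul, Measure.integral_comp_mul_left
    (fun b : ℝ => 𝐞 (b * t ^ 2) • |b| ^ m • 𝓕 P b), ← rieszDerivative_eq_integral, inv_inv,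
    abs_of_pos Real.two_pi_pos, smul_smul, ← pow_succ]

lemma hasFinitePart_rieszDerivative (hh : IntegrableOn h (Ioi 0)) (hPc : Continuous P)
    (hPi : Integrable P) (hF : Integrable (𝓕 P)) (hF' : Integrable fun b : ℝ => |b| • 𝓕 P b)
    (c : ℝ) : HasFinitePart h c (-(2 * Real.pi ^ 2) • rieszDerivative 1 P c) := by
  have hsq : Measurable fun τ : ℝ => τ ^ 2 := by fun_prop
  have hmeas : ∀ ε : ℝ, MeasurableSet {s : ℝ | ε < |c - s|} := fun ε =>
    measurableSet_lt measurable_const (by fun_prop)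
  have hpre : ∀ ε : ℝ, {t : ℝ | 0 < t ∧ ε < |c - t ^ 2|}
      = (fun τ : ℝ => τ ^ 2) ⁻¹' {s | ε < |c - s|} ∩ Ioi 0 := fun ε => by
    ext t
    exact and_comm
  have hsmul : ∀ t : ℝ, h t / (((c - t ^ 2) ^ 2 : ℝ) : ℂ) = ((c - t ^ 2) ^ 2)⁻¹ • h t :=
    fun t => by rw [Complex.real_smul, Complex.ofReal_inv, div_eq_inv_mul]
  have hbound : ∀ {ε : ℝ}, 0 < ε → ∀ s ∈ {s : ℝ | ε < |c - s|}, |((c - s) ^ 2)⁻¹| ≤ (ε ^ 2)⁻¹ := by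
    intro ε hε s (hs : ε < |c - s|)
    rw [abs_inv, abs_pow]
    gcongr
  simp only [HasFinitePart, hpre, hsmul]
  refine ⟨fun ε hε => ?_, 2 * P c, ?_⟩
  · refine (hh.mono_set inter_subset_right).bdd_smul
      (φ := fun t : ℝ => ((c - t ^ 2) ^ 2)⁻¹) (ε ^ 2)⁻¹
      (Measurable.aestronglyMeasurable (by fun_prop)) ?_
    filter_upwards [ae_restrict_mem ((hsq (hmeas ε)).inter measurableSet_Ioi)] with t ht
    exact hbound hε _ ht.1
  · refine (tendsto_finitePart_inv_sq hPc hPi hF hF' c).congr' ?_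
    filter_upwards [self_mem_nhdsWithin] with ε (hε : 0 < ε)
    have hpull := hP.setIntegral_smul_eq hsq (hmeas ε)
      (k := fun s => ((c - s) ^ 2)⁻¹) (by fun_prop) (hbound hε)
    rw [Measure.restrict_restrict (hsq (hmeas ε))] at hpull
    rw [← hpull, Complex.real_smul]
    push_cast
    rw [div_mul_eq_mul_div]

lemma hasFinitePart_Lambda (hh : IntegrableOn h (Ioi 0)) (hPc : Continuous P)
    (hPi : Integrable P) (hF : Integrable (𝓕 P)) (hF' : Integrable fun b : ℝ => |b| • 𝓕 P b)
    (t : ℝ) : HasFinitePart h (t ^ 2) (-(1 / 2) * Lambda 2 h t) := by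
  convert hasFinitePart_rieszDerivative hP hh hPc hPi hF hF' (t ^ 2) using 1
  rw [Lambda_eq_rieszDerivative hP, Complex.real_smul, Complex.real_smul]
  push_cast
  ring

end Lambda

/-! ### Euclidean coordinates -/

section Geometry

section DiagInv

variable {m : ℕ} {a : Fin m → ℝ}

@[simp]
lemma diagInv_apply (a : Fin m → ℝ) (x : EuclideanSpace ℝ (Fin m)) (i : Fin m) :
    diagInv a x i = (a i)⁻¹ * x i := rfl

lemma diagInv_eq_toEuclideanLin (a : Fin m → ℝ) :
    diagInv a = (Matrix.diagonal fun i => (a i)⁻¹).toEuclideanLin := by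
  ext x i
  simp [Matrix.mulVec_diagonal]

lemma diagInv_sub (a : Fin m → ℝ) (x y : EuclideanSpace ℝ (Fin m)) :
    diagInv a (x - y) = diagInv a x - diagInv a y := by
  rw [diagInv_eq_toEuclideanLin, map_sub]

lemma contDiff_diagInv (a : Fin m → ℝ) : ContDiff ℝ ∞ (diagInv a) := by
  simp only [contDiff_euclidean, diagInv_apply]
  fun_prop

lemma diagInv_inv_diagInv (ha : ∀ i, a i ≠ 0) (x : EuclideanSpace ℝ (Fin m)) :
    diagInv (fun i => (a i)⁻¹) (diagInv a x) = x := by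
  ext i
  simp [ha i]

lemma diagInv_diagInv_inv (ha : ∀ i, a i ≠ 0) (x : EuclideanSpace ℝ (Fin m)) :
    diagInv a (diagInv (fun i => (a i)⁻¹) x) = x := by
  ext i
  simp [ha i]

/-- `x ↦ A⁻¹ x` as a homeomorphism, for an invertible diagonal matrix `A`. -/
def diagInvHomeomorph (a : Fin m → ℝ) (ha : ∀ i, a i ≠ 0) :
    EuclideanSpace ℝ (Fin m) ≃ₜ EuclideanSpace ℝ (Fin m) where
  toFun := diagInv a
  invFun := diagInv fun i => (a i)⁻¹
  left_inv := diagInv_inv_diagInv ha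
  right_inv := diagInv_diagInv_inv ha
  continuous_toFun := (contDiff_diagInv a).continuous
  continuous_invFun := (contDiff_diagInv _).continuous

lemma map_diagInv_volume (ha : ∀ i, a i ≠ 0) :
    Measure.map (diagInv a) volume = ENNReal.ofReal |∏ i, a i| • volume := by
  have hdet : LinearMap.det (Matrix.diagonal fun i => (a i)⁻¹).toEuclideanLin
      = (∏ i, a i)⁻¹ := by
    rw [Matrix.toEuclideanLin_eq_toLin_orthonormal, LinearMap.det_toLin, Matrix.det_diagonal,
      Finset.prod_inv_distrib]
  rw [diagInv_eq_toEuclideanLin, Measure.map_linearMap_addHaar_eq_smul_addHaar, hdet, inv_inv]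
  rw [hdet]
  exact inv_ne_zero (Finset.prod_ne_zero_iff.2 fun i _ => ha i)

lemma measurableEmbedding_diagInv (ha : ∀ i, a i ≠ 0) : MeasurableEmbedding (diagInv a) :=
  (diagInvHomeomorph a ha).measurableEmbedding

variable {F : Type*} [NormedAddCommGroup F]

lemma integral_comp_diagInv [NormedSpace ℝ F] (ha : ∀ i, a i ≠ 0)
    (g : EuclideanSpace ℝ (Fin m) → F) :
    ∫ x, g (diagInv a x) = |∏ i, a i| • ∫ y, g y := by
  rw [← (measurableEmbedding_diagInv ha).integral_map, map_diagInv_volume ha,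
    integral_smul_measure, ENNReal.toReal_ofReal (abs_nonneg _)]

lemma integrable_comp_diagInv (ha : ∀ i, a i ≠ 0) {g : EuclideanSpace ℝ (Fin m) → F}
    (hg : Integrable g) : Integrable fun x => g (diagInv a x) := by
  refine (measurableEmbedding_diagInv ha).integrable_map_iff.1 ?_
  rw [map_diagInv_volume ha]
  exact hg.smul_measure ENNReal.ofReal_ne_top

end DiagInv

variable {d : ℕ}

@[simp]
lemma point_castSucc (y : EuclideanSpace ℝ (Fin d)) (s : ℝ) (i : Fin d) :
    point y s i.castSucc = y i := by
  simp [point]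

@[simp]
lemma point_last (y : EuclideanSpace ℝ (Fin d)) (s : ℝ) : point y s (Fin.last d) = s := by
  simp [point]

lemma norm_point_sub_point_sq (y u : EuclideanSpace ℝ (Fin d)) (s t : ℝ) :
    ‖point y s - point u t‖ ^ 2 = ‖y - u‖ ^ 2 + (s - t) ^ 2 := by
  simp [EuclideanSpace.norm_sq_eq, Fin.sum_univ_castSucc]

lemma diagInv_point (a : Fin (d + 1) → ℝ) (y : EuclideanSpace ℝ (Fin d)) (s : ℝ) :
    diagInv a (point y s)
      = point (diagInv (fun i => a i.castSucc) y) ((a (Fin.last d))⁻¹ * s) := by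
  ext i
  cases i using Fin.lastCases <;> simp

/-- `(y, s) ↦ point y s` as an isometry from the Euclidean product. -/
def pointIsometry (d : ℕ) :
    WithLp 2 (EuclideanSpace ℝ (Fin d) × ℝ) ≃ₗᵢ[ℝ] EuclideanSpace ℝ (Fin (d + 1)) where
  toFun w := point w.fst w.snd
  invFun x := WithLp.toLp 2 (WithLp.toLp 2 fun i => x i.castSucc, x (Fin.last d))
  left_inv w := WithLp.ofLp_injective 2 (Prod.ext (by ext i; simp) (by simp))
  right_inv x := by
    ext i
    cases i using Fin.lastCases <;> simp
  map_add' v w := by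
    ext i
    cases i using Fin.lastCases <;> simp
  map_smul' c w := by
    ext i
    cases i using Fin.lastCases <;> simp
  norm_map' w := by
    rw [← sq_eq_sq₀ (norm_nonneg _) (norm_nonneg _), WithLp.prod_norm_sq_eq_of_L2]
    simp [EuclideanSpace.norm_sq_eq, Fin.sum_univ_castSucc]

lemma measurePreserving_point :
    MeasurePreserving fun z : EuclideanSpace ℝ (Fin d) × ℝ => point z.1 z.2 :=
  (pointIsometry d).measurePreserving.comp (WithLp.volume_preserving_toLp _ ℝ)

lemma measurableEmbedding_point :
    MeasurableEmbedding fun z : EuclideanSpace ℝ (Fin d) × ℝ => point z.1 z.2 :=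
  (pointIsometry d).toHomeomorph.measurableEmbedding.comp
    (MeasurableEquiv.toLp 2 (EuclideanSpace ℝ (Fin d) × ℝ)).measurableEmbedding

lemma contDiff_point : ContDiff ℝ ∞ fun z : EuclideanSpace ℝ (Fin d) × ℝ => point z.1 z.2 := by
  refine contDiff_euclidean.2 fun i => ?_
  cases i using Fin.lastCases <;> simp only [point_last, point_castSucc] <;> fun_prop

end Geometry

/-! ### Squaring the last variable -/

section SquareProfile

variable {d : ℕ} {g : EuclideanSpace ℝ (Fin (d + 1)) → ℂ}

lemma Admissible.comp_diagInv (hg : Admissible g) {b : Fin (d + 1) → ℝ} (hb : ∀ i, b i ≠ 0) :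
    Admissible fun x => g (diagInv b x) where
  smooth := hg.smooth.comp (contDiff_diagInv b)
  compactSupport := hg.compactSupport.comp_homeomorph (diagInvHomeomorph b hb)
  support_subset x hx h0 :=
    hg.support_subset (tsupport_comp_subset_preimage g (contDiff_diagInv b).continuous hx)
      (by rw [diagInv_apply, h0, mul_zero])
  even y s := by rw [diagInv_point, diagInv_point, mul_neg, hg.even]

lemma Admissible.integrable (hg : Admissible g) : Integrable g :=
  hg.smooth.continuous.integrable_of_hasCompactSupport hg.compactSupport

lemma Admissible.exists_eq_zero_of_abs_last_lt (hg : Admissible g) :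
    ∃ δ > 0, ∀ x, |x (Fin.last d)| < δ → g x = 0 := by
  let heights := (fun x : EuclideanSpace ℝ (Fin (d + 1)) => x (Fin.last d)) '' tsupport g
  have hcompact : IsCompact heights := hg.compactSupport.isCompact.image (by fun_prop)
  have hzero : (0 : ℝ) ∈ heightsᶜ := fun ⟨x, hx, hx0⟩ => hg.support_subset hx hx0
  obtain ⟨δ, hδ, hball⟩ := Metric.isOpen_iff.1 hcompact.isClosed.isOpen_compl 0 hzero
  refine ⟨δ, hδ, fun x hx => ?_⟩
  by_contra hne
  exact hball (mem_ball_zero_iff.2 hx) ⟨x, subset_tsupport g hne, rfl⟩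

/-- For `g` even in the last variable, the density of the image of `g (y, s) ds` under `v = s²`.
It vanishes for `v ≤ 0` by the conventions `√v = 0` and `0⁻¹ = 0`. -/
def squareProfile (g : EuclideanSpace ℝ (Fin (d + 1)) → ℂ) (z : EuclideanSpace ℝ (Fin d) × ℝ) :
    ℂ :=
  (√z.2)⁻¹ • g (point z.1 √z.2)

lemma squareProfile_of_nonpos (g : EuclideanSpace ℝ (Fin (d + 1)) → ℂ)
    {z : EuclideanSpace ℝ (Fin d) × ℝ} (hz : z.2 ≤ 0) : squareProfile g z = 0 := by
  rw [squareProfile, Real.sqrt_eq_zero_of_nonpos hz, inv_zero, zero_smul]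

lemma Admissible.contDiff_squareProfile (hg : Admissible g) : ContDiff ℝ ∞ (squareProfile g) := by
  refine contDiff_iff_contDiffAt.2 fun z => ?_
  rcases lt_or_ge 0 z.2 with hz | hz
  · have hsqrt : ContDiffAt ℝ ∞ (fun z : EuclideanSpace ℝ (Fin d) × ℝ => √z.2) z :=
      contDiffAt_snd.sqrt hz.ne'
    exact (hsqrt.inv (Real.sqrt_pos.2 hz).ne').smul
      ((hg.smooth.comp contDiff_point).contDiffAt.comp z (contDiffAt_fst.prodMk hsqrt))
  · obtain ⟨δ, hδ, hzero⟩ := hg.exists_eq_zero_of_abs_last_lt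
    refine (contDiffAt_const (c := (0 : ℂ))).congr_of_eventuallyEq ?_
    filter_upwards [continuous_snd.continuousAt.eventually
      (gt_mem_nhds (hz.trans_lt (sq_pos_of_pos hδ)))] with w hw
    rw [squareProfile, hzero, smul_zero]
    rw [point_last, abs_of_nonneg (Real.sqrt_nonneg _)]
    exact (Real.sqrt_lt' hδ).2 hw

lemma Admissible.hasCompactSupport_squareProfile (hg : Admissible g) :
    HasCompactSupport (squareProfile g) := by
  let sq (x : EuclideanSpace ℝ (Fin (d + 1))) : EuclideanSpace ℝ (Fin d) × ℝ :=
    (((pointIsometry d).symm x).fst, ((pointIsometry d).symm x).snd ^ 2)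
  have hsq : Continuous sq := by fun_prop
  refine HasCompactSupport.intro (hg.compactSupport.isCompact.image hsq) fun z hz => ?_
  rcases le_or_gt z.2 0 with hz0 | hz0
  · exact squareProfile_of_nonpos g hz0
  · have hsqz : sq (point z.1 √z.2) = z := by
      have hsymm : (pointIsometry d).symm (point z.1 √z.2) = WithLp.toLp 2 (z.1, √z.2) :=
        (pointIsometry d).symm_apply_apply (WithLp.toLp 2 (z.1, √z.2))
      exact Prod.ext (by simp [sq, hsymm]) (by simp [sq, hsymm, Real.sq_sqrt hz0.le])
    by_contra hne
    exact hz ⟨_, subset_tsupport g fun h0 => hne (by rw [squareProfile, h0, smul_zero]), hsqz⟩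

lemma Admissible.integrable_squareProfile (hg : Admissible g) : Integrable (squareProfile g) :=
  hg.contDiff_squareProfile.continuous.integrable_of_hasCompactSupport
    hg.hasCompactSupport_squareProfile

lemma Admissible.integral_smul_squareProfile (hg : Admissible g)
    {k : EuclideanSpace ℝ (Fin d) × ℝ → ℂ} (hk : Measurable k) {M : ℝ} (hM : ∀ z, ‖k z‖ ≤ M) :
    ∫ z, k z • squareProfile g z
      = ∫ z : EuclideanSpace ℝ (Fin d) × ℝ, k (z.1, z.2 ^ 2) • g (point z.1 z.2) := by
  have hint : Integrable fun z : EuclideanSpace ℝ (Fin d) × ℝ =>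
      k (z.1, z.2 ^ 2) • g (point z.1 z.2) :=
    ((measurePreserving_point.integrable_comp_emb measurableEmbedding_point).2
      hg.integrable).bdd_smul (φ := fun z : EuclideanSpace ℝ (Fin d) × ℝ => k (z.1, z.2 ^ 2)) M
      (hk.comp (by fun_prop)).aestronglyMeasurable (Eventually.of_forall fun z => hM _)
  have hint' : Integrable fun z => k z • squareProfile g z :=
    hg.integrable_squareProfile.bdd_smul M hk.aestronglyMeasurable (Eventually.of_forall hM)
  rw [Measure.volume_eq_prod] at hint hint' ⊢
  rw [integral_prod _ hint, integral_prod _ hint']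
  refine integral_congr_ae ?_
  filter_upwards [hint.prod_right_ae] with y hy
  rw [integral_eq_integral_Ioi_sqrt_of_even hy fun s => by simp only [neg_sq, hg.even],
    ← setIntegral_Ioi_eq_integral fun v hv => by rw [squareProfile_of_nonpos g hv, smul_zero]]
  refine setIntegral_congr_fun measurableSet_Ioi fun v (hv : 0 < v) => ?_
  simp only [squareProfile, Real.sq_sqrt hv.le]
  rw [smul_comm]

lemma Admissible.hasImageDensity_norm_sub_sq (hg : Admissible g) (α : EuclideanSpace ℝ (Fin d)) :
    HasImageDensity volume (fun x => ‖x - point α 0‖ ^ 2) g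
      (paraboloidIntegral (squareProfile g) α) := by
  intro k hk hM
  rw [← hasImageDensity_paraboloidIntegral hg.integrable_squareProfile α k hk hM,
    hg.integral_smul_squareProfile (k := fun z => k (z.2 + ‖z.1 - α‖ ^ 2))
      (hk.comp (by fun_prop)) fun z => hM.choose_spec _,
    ← measurePreserving_point.integral_comp measurableEmbedding_point]
  simp only [norm_point_sub_point_sq, sub_zero, add_comm]

end SquareProfile

/-! ### The elliptical Radon transform -/

section Radon

variable {d : ℕ} {a : Fin (d + 1) → ℝ} {f : EuclideanSpace ℝ (Fin (d + 1)) → ℂ}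

/-- The density of the image of `f(x) dx` under `x ↦ A⁻¹ x`. -/
def diagPushforward (a : Fin (d + 1) → ℝ) (f : EuclideanSpace ℝ (Fin (d + 1)) → ℂ)
    (y : EuclideanSpace ℝ (Fin (d + 1))) : ℂ :=
  |∏ i, a i| • f (diagInv (fun i => (a i)⁻¹) y)

lemma admissible_diagPushforward (ha : ∀ i, a i ≠ 0) (hf : Admissible f) :
    Admissible (diagPushforward a f) := by
  have h : Admissible fun y => f (diagInv (fun i => (a i)⁻¹) y) :=
    hf.comp_diagInv fun i => inv_ne_zero (ha i)
  refine ⟨h.smooth.const_smul |∏ i, a i|, ?_, ?_, fun y s => ?_⟩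
  · exact h.compactSupport.smul_left (f := fun _ => |∏ i, a i|)
  · exact (tsupport_smul_subset_right (fun _ => |∏ i, a i|) _).trans h.support_subset
  · rw [diagPushforward, h.even, diagPushforward]

lemma integral_comp_diagInv_smul (ha : ∀ i, a i ≠ 0)
    (k : EuclideanSpace ℝ (Fin (d + 1)) → ℂ) :
    ∫ x, k (diagInv a x) • f x = ∫ y, k y • diagPushforward a f y := by
  have h := integral_comp_diagInv ha fun y => k y • f (diagInv (fun i => (a i)⁻¹) y)
  simp only [diagInv_inv_diagInv ha] at h
  rw [h, ← integral_smul]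
  simp only [diagPushforward, smul_comm |∏ i, a i|]

/-- The density of the image of `f(x) dx` under `s = |A⁻¹ (x - (u, 0))|²`. -/
def radiusSqDensity (a : Fin (d + 1) → ℝ) (f : EuclideanSpace ℝ (Fin (d + 1)) → ℂ)
    (u : EuclideanSpace ℝ (Fin d)) : ℝ → ℂ :=
  paraboloidIntegral (squareProfile (diagPushforward a f)) (diagInv (fun i => a i.castSucc) u)

lemma continuous_radiusSqDensity (ha : ∀ i, a i ≠ 0) (hf : Admissible f)
    (u : EuclideanSpace ℝ (Fin d)) : Continuous (radiusSqDensity a f u) :=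
  continuous_paraboloidIntegral (admissible_diagPushforward ha hf).contDiff_squareProfile.continuous
    (admissible_diagPushforward ha hf).hasCompactSupport_squareProfile _

lemma integrable_radiusSqDensity (ha : ∀ i, a i ≠ 0) (hf : Admissible f)
    (u : EuclideanSpace ℝ (Fin d)) : Integrable (radiusSqDensity a f u) :=
  integrable_paraboloidIntegral (admissible_diagPushforward ha hf).integrable_squareProfile _

lemma integrable_pow_smul_fourier_radiusSqDensity (ha : ∀ i, a i ≠ 0) (hf : Admissible f) (m : ℕ)
    (u : EuclideanSpace ℝ (Fin d)) :
    Integrable fun b : ℝ => |b| ^ m • 𝓕 (radiusSqDensity a f u) b :=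
  integrable_pow_smul_fourier_paraboloidIntegral
    (admissible_diagPushforward ha hf).contDiff_squareProfile
    (admissible_diagPushforward ha hf).hasCompactSupport_squareProfile m _

lemma radiusSqDensity_of_nonpos (a : Fin (d + 1) → ℝ) (f : EuclideanSpace ℝ (Fin (d + 1)) → ℂ)
    (u : EuclideanSpace ℝ (Fin d)) {s : ℝ} (hs : s ≤ 0) : radiusSqDensity a f u s = 0 :=
  integral_eq_zero_of_ae <| Eventually.of_forall fun _ =>
    squareProfile_of_nonpos _ (sub_nonpos.2 (hs.trans (sq_nonneg _)))

lemma hasImageDensity_ellipsoidalRadius_sq (ha : ∀ i, a i ≠ 0) (hf : Admissible f)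
    (u : EuclideanSpace ℝ (Fin d)) :
    HasImageDensity volume (fun x => ellipsoidalRadius a u x ^ 2) f (radiusSqDensity a f u) := by
  intro k hk hM
  rw [radiusSqDensity, ← (admissible_diagPushforward ha hf).hasImageDensity_norm_sub_sq _ k hk hM,
    ← integral_comp_diagInv_smul ha]
  simp only [ellipsoidalRadius, diagInv_sub, diagInv_point, mul_zero]

lemma hasDeltaIntegral_ellipsoidalRadius (ha : ∀ i, a i ≠ 0) (hf : Admissible f)
    (u : EuclideanSpace ℝ (Fin d)) (t : ℝ) :
    HasDeltaIntegral (ellipsoidalRadius a u) t f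
      ((2 * max t 0) • radiusSqDensity a f u (t ^ 2)) := by
  have hcont := continuous_radiusSqDensity ha hf u
  have hmeas : Measurable (ellipsoidalRadius a u) :=
    ((contDiff_diagInv a).continuous.comp (continuous_id.sub continuous_const)).norm.measurable
  exact ((hasImageDensity_ellipsoidalRadius_sq ha hf u).of_sq (fun _ => norm_nonneg _)
    fun s => radiusSqDensity_of_nonpos a f u).hasDeltaIntegral hmeas (by fun_prop) t

lemma ellipticalRadon_eq (ha : ∀ i, a i ≠ 0) (hf : Admissible f)
    (u : EuclideanSpace ℝ (Fin d)) (t : ℝ) :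
    ellipticalRadon a f u t = (2 * max t 0) • radiusSqDensity a f u (t ^ 2) :=
  (hasDeltaIntegral_ellipsoidalRadius ha hf u t).limUnder_eq

lemma ellipticalRadon_of_pos (ha : ∀ i, a i ≠ 0) (hf : Admissible f)
    (u : EuclideanSpace ℝ (Fin d)) {t : ℝ} (ht : 0 < t) :
    ellipticalRadon a f u t = (2 * t) • radiusSqDensity a f u (t ^ 2) := by
  rw [ellipticalRadon_eq ha hf, max_eq_left ht.le]

lemma integrableOn_ellipticalRadon (ha : ∀ i, a i ≠ 0) (hf : Admissible f)
    (u : EuclideanSpace ℝ (Fin d)) : IntegrableOn (ellipticalRadon a f u) (Ioi 0) :=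
  (integrableOn_Ioi_comp_sq (integrable_radiusSqDensity ha hf u).integrableOn).congr_fun
    (fun _ ht => (ellipticalRadon_of_pos ha hf u ht).symm) measurableSet_Ioi

lemma hasImageDensity_sq_ellipticalRadon (ha : ∀ i, a i ≠ 0) (hf : Admissible f)
    (u : EuclideanSpace ℝ (Fin d)) :
    HasImageDensity (volume.restrict (Ioi 0)) (fun τ : ℝ => τ ^ 2) (ellipticalRadon a f u)
      (radiusSqDensity a f u) :=
  hasImageDensity_sq (fun _ => radiusSqDensity_of_nonpos a f u)
    fun _ => ellipticalRadon_of_pos ha hf u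

lemma lambdaConverges_ellipticalRadon (ha : ∀ i, a i ≠ 0) (hf : Admissible f)
    (u : EuclideanSpace ℝ (Fin d)) (m : ℕ) (t : ℝ) :
    LambdaConverges (m + 1) (ellipticalRadon a f u) t :=
  lambdaConverges (hasImageDensity_sq_ellipticalRadon ha hf u)
    (integrableOn_ellipticalRadon ha hf u)
    (integrable_pow_smul_fourier_radiusSqDensity ha hf m u) t

lemma hasFinitePart_ellipticalRadon (ha : ∀ i, a i ≠ 0) (hf : Admissible f)
    (u : EuclideanSpace ℝ (Fin d)) (t : ℝ) :
    HasFinitePart (ellipticalRadon a f u) (t ^ 2)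
      (-(1 / 2) * Lambda 2 (ellipticalRadon a f u) t) := by
  refine hasFinitePart_Lambda (hasImageDensity_sq_ellipticalRadon ha hf u)
    (integrableOn_ellipticalRadon ha hf u) (continuous_radiusSqDensity ha hf u)
    (integrable_radiusSqDensity ha hf u) ?_ ?_ t
  · simpa only [pow_zero, one_smul] using integrable_pow_smul_fourier_radiusSqDensity ha hf 0 u
  · simpa only [pow_one] using integrable_pow_smul_fourier_radiusSqDensity ha hf 1 u

/-! ### Inversion -/

lemma evalTime_sq (a : Fin (d + 1) → ℝ) (x' : EuclideanSpace ℝ (Fin d)) (xn : ℝ)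
    (α : EuclideanSpace ℝ (Fin d)) :
    evalTime a x' xn α ^ 2
      = ‖diagInv (fun i => a i.castSucc) α - diagInv (fun i => a i.castSucc) x'‖ ^ 2
        + ((a (Fin.last d)) ^ 2)⁻¹ * xn ^ 2 := by
  rw [evalTime, Real.sq_sqrt (by positivity), diagInv_sub]

lemma squareProfile_diagPushforward (ha : ∀ i, a i ≠ 0) (hf : Admissible f)
    (x' : EuclideanSpace ℝ (Fin d)) (xn : ℝ) :
    squareProfile (diagPushforward a f)
        (diagInv (fun i => a i.castSucc) x', ((a (Fin.last d)) ^ 2)⁻¹ * xn ^ 2)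
      = (|a (Fin.last d)| / |xn| * |∏ i, a i|) • f (point x' xn) := by
  have hsqrt : √(((a (Fin.last d)) ^ 2)⁻¹ * xn ^ 2) = |(a (Fin.last d))⁻¹ * xn| := by
    rw [← inv_pow, ← mul_pow, Real.sqrt_sq_eq_abs]
  have heven (s : ℝ) : diagPushforward a f (point (diagInv (fun i => a i.castSucc) x') |s|)
      = diagPushforward a f (point (diagInv (fun i => a i.castSucc) x') s) := by
    rcases abs_choice s with h | h <;> rw [h]
    exact (admissible_diagPushforward ha hf).even _ s
  rw [squareProfile, hsqrt, heven, ← diagInv_point, diagPushforward, diagInv_inv_diagInv ha,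
    smul_smul, abs_mul, abs_inv, mul_inv, inv_inv, div_eq_mul_inv]

lemma Lambda_ellipticalRadon (ha : ∀ i, a i ≠ 0) (hf : Admissible f)
    (x' : EuclideanSpace ℝ (Fin d)) (xn : ℝ) (α : EuclideanSpace ℝ (Fin d)) :
    Lambda (d + 1) (ellipticalRadon a f α) (evalTime a x' xn α)
      = (2 * Real.pi) ^ (d + 1) • rieszDerivative d (radiusSqDensity a f α)
        (‖diagInv (fun i => a i.castSucc) α - diagInv (fun i => a i.castSucc) x'‖ ^ 2
          + ((a (Fin.last d)) ^ 2)⁻¹ * xn ^ 2) := by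
  rw [Lambda_eq_rieszDerivative (hasImageDensity_sq_ellipticalRadon ha hf α), evalTime_sq]

lemma integrable_Lambda_ellipticalRadon (ha : ∀ i, a i ≠ 0) (hf : Admissible f)
    (x' : EuclideanSpace ℝ (Fin d)) (xn : ℝ) :
    Integrable fun α => Lambda (d + 1) (ellipticalRadon a f α) (evalTime a x' xn α) := by
  have h := integrable_rieszDerivative_paraboloidIntegral
    (admissible_diagPushforward ha hf).contDiff_squareProfile
    (admissible_diagPushforward ha hf).hasCompactSupport_squareProfile
    (diagInv (fun i => a i.castSucc) x') (((a (Fin.last d)) ^ 2)⁻¹ * xn ^ 2)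
  rw [finrank_euclideanSpace_fin] at h
  simp_rw [Lambda_ellipticalRadon ha hf]
  exact (integrable_comp_diagInv (fun i => ha i.castSucc) h).smul ((2 * Real.pi) ^ (d + 1))

lemma integral_Lambda_ellipticalRadon (ha : ∀ i, a i ≠ 0) (hf : Admissible f)
    (x' : EuclideanSpace ℝ (Fin d)) (xn : ℝ) :
    ∫ α, Lambda (d + 1) (ellipticalRadon a f α) (evalTime a x' xn α)
      = (2 * Real.pi ^ (d + 1) * (∏ i, a i) ^ 2 / |xn|) • f (point x' xn) := by
  have h := integral_rieszDerivative_paraboloidIntegral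
    (admissible_diagPushforward ha hf).contDiff_squareProfile
    (admissible_diagPushforward ha hf).hasCompactSupport_squareProfile
    (diagInv (fun i => a i.castSucc) x') (((a (Fin.last d)) ^ 2)⁻¹ * xn ^ 2)
  rw [finrank_euclideanSpace_fin, squareProfile_diagPushforward ha hf] at h
  simp_rw [Lambda_ellipticalRadon ha hf, radiusSqDensity]
  rw [integral_smul, integral_comp_diagInv (fun i => ha i.castSucc) fun α =>
    rieszDerivative d (paraboloidIntegral (squareProfile (diagPushforward a f)) α)
      (‖α - diagInv (fun i => a i.castSucc) x'‖ ^ 2 + ((a (Fin.last d)) ^ 2)⁻¹ * xn ^ 2), h]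
  simp only [smul_smul]
  congr 1
  rw [← sq_abs (∏ i, a i), Fin.prod_univ_castSucc, abs_mul]
  field_simp
  ring

theorem inversion_formula (ha : ∀ i, a i ≠ 0) (hf : Admissible f)
    (x' : EuclideanSpace ℝ (Fin d)) (xn : ℝ) :
    f (point x' xn) = ((|xn| / (2 * Real.pi ^ (d + 1) * (∏ i, a i) ^ 2) : ℝ) : ℂ)
      * ∫ α, Lambda (d + 1) (ellipticalRadon a f α) (evalTime a x' xn α) := by
  rw [← Complex.real_smul, integral_Lambda_ellipticalRadon ha hf, smul_smul]
  rcases eq_or_ne xn 0 with rfl | hx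
  · have hzero : point x' 0 ∉ tsupport f := fun h => hf.support_subset h (point_last x' 0)
    rw [image_eq_zero_of_notMem_tsupport hzero, smul_zero]
  · have hprod : ∏ i, a i ≠ 0 := Finset.prod_ne_zero_iff.2 fun i _ => ha i
    rw [div_mul_div_cancel₀' (by positivity), div_self (by positivity), one_smul]

end Radon

/-! ### The plane -/

section Planar

lemma toEuclideanFinOne_eq_comp : (fun α : ℝ => (!₂[α] : EuclideanSpace ℝ (Fin 1)))
    = MeasurableEquiv.toLp 2 (Fin 1 → ℝ) ∘ (MeasurableEquiv.funUnique (Fin 1) ℝ).symm := by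
  ext α i
  fin_cases i
  rfl

lemma measurePreserving_toEuclideanFinOne :
    MeasurePreserving fun α : ℝ => (!₂[α] : EuclideanSpace ℝ (Fin 1)) := by
  rw [toEuclideanFinOne_eq_comp]
  exact (PiLp.volume_preserving_toLp (Fin 1)).comp (volume_preserving_funUnique (Fin 1) ℝ).symm

lemma measurableEmbedding_toEuclideanFinOne :
    MeasurableEmbedding fun α : ℝ => (!₂[α] : EuclideanSpace ℝ (Fin 1)) := by
  rw [toEuclideanFinOne_eq_comp]
  exact (MeasurableEquiv.toLp 2 (Fin 1 → ℝ)).measurableEmbedding.comp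
    (MeasurableEquiv.funUnique (Fin 1) ℝ).symm.measurableEmbedding

lemma point_toEuclideanFinOne (x₁ x₂ : ℝ) :
    point (!₂[x₁] : EuclideanSpace ℝ (Fin 1)) x₂ = !₂[x₁, x₂] := by
  ext i
  fin_cases i <;> rfl

lemma evalTime_toEuclideanFinOne_sq (a₁ a₂ x₁ x₂ α : ℝ) :
    evalTime (d := 1) ![a₁, a₂] (!₂[x₁]) x₂ (!₂[α]) ^ 2
      = |a₁⁻¹ * (α - x₁)| ^ 2 + (a₂ ^ 2)⁻¹ * x₂ ^ 2 := by
  rw [evalTime_sq]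
  simp [EuclideanSpace.norm_sq_eq, Fin.last, mul_sub]

variable {a₁ a₂ : ℝ} {f : EuclideanSpace ℝ (Fin 2) → ℂ}

lemma hasFinitePart_planar_ellipticalRadon (h₁ : a₁ ≠ 0) (h₂ : a₂ ≠ 0)
    (hf : Admissible (d := 1) f) (x₁ x₂ α : ℝ) :
    HasFinitePart (ellipticalRadon (d := 1) ![a₁, a₂] f (!₂[α]))
      (|a₁⁻¹ * (α - x₁)| ^ 2 + (a₂ ^ 2)⁻¹ * x₂ ^ 2)
      (-(1 / 2) * Lambda 2 (ellipticalRadon (d := 1) ![a₁, a₂] f (!₂[α]))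
        (evalTime (d := 1) ![a₁, a₂] (!₂[x₁]) x₂ (!₂[α]))) := by
  rw [← evalTime_toEuclideanFinOne_sq]
  exact hasFinitePart_ellipticalRadon (d := 1) (Fin.forall_fin_two.2 ⟨h₁, h₂⟩) hf _ _

lemma integrable_planar_Lambda_ellipticalRadon (h₁ : a₁ ≠ 0) (h₂ : a₂ ≠ 0)
    (hf : Admissible (d := 1) f) (x₁ x₂ : ℝ) :
    Integrable fun α : ℝ => Lambda 2 (ellipticalRadon (d := 1) ![a₁, a₂] f (!₂[α]))
      (evalTime (d := 1) ![a₁, a₂] (!₂[x₁]) x₂ (!₂[α])) :=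
  (measurePreserving_toEuclideanFinOne.integrable_comp_emb
    measurableEmbedding_toEuclideanFinOne).2
    (integrable_Lambda_ellipticalRadon (d := 1) (Fin.forall_fin_two.2 ⟨h₁, h₂⟩) hf _ _)

theorem planar_inversion_formula (h₁ : a₁ ≠ 0) (h₂ : a₂ ≠ 0) (hf : Admissible (d := 1) f)
    (x₁ x₂ : ℝ) :
    f (!₂[x₁, x₂]) = -((|x₂| / (Real.pi ^ 2 * a₁ ^ 2 * a₂ ^ 2) : ℝ) : ℂ)
      * ∫ α : ℝ, -(1 / 2) * Lambda 2 (ellipticalRadon (d := 1) ![a₁, a₂] f (!₂[α]))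
        (evalTime (d := 1) ![a₁, a₂] (!₂[x₁]) x₂ (!₂[α])) := by
  have h := inversion_formula (d := 1) (a := ![a₁, a₂]) (Fin.forall_fin_two.2 ⟨h₁, h₂⟩) hf
    (!₂[x₁]) x₂
  rw [point_toEuclideanFinOne, ← measurePreserving_toEuclideanFinOne.integral_comp
    measurableEmbedding_toEuclideanFinOne] at h
  rw [h, integral_const_mul, ← mul_assoc, Fin.prod_univ_two]
  simp only [Matrix.cons_val_zero, Matrix.cons_val_one]
  congr 1
  push_cast
  ring

end Planar

end

end EllipticalRadon

theorem mainTheorem1 :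
    -- the inversion formula in dimension `n = d + 1 ≥ 2`
    (∀ (d : ℕ), 1 ≤ d → ∀ (a : Fin (d + 1) → ℝ), (∀ i, 0 < a i) →
      ∀ (f : EuclideanSpace ℝ (Fin (d + 1)) → ℂ), Admissible f →
        (∀ (u : EuclideanSpace ℝ (Fin d)) (t : ℝ), 0 ≤ t →
          HasDeltaIntegral (ellipsoidalRadius a u) t f (ellipticalRadon a f u t)) ∧
        ∀ (x' : EuclideanSpace ℝ (Fin d)) (xn : ℝ),
          (∀ α, LambdaConverges (d + 1) (ellipticalRadon a f α) (evalTime a x' xn α)) ∧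
          Integrable (fun α => Lambda (d + 1) (ellipticalRadon a f α) (evalTime a x' xn α)) ∧
          f (point x' xn) = ((|xn| / (2 * Real.pi ^ (d + 1) * (∏ i, a i) ^ 2) : ℝ) : ℂ)
            * ∫ α, Lambda (d + 1) (ellipticalRadon a f α) (evalTime a x' xn α)) ∧
    -- the kernel formula in dimension `n = 2`
    (∀ (a₁ a₂ : ℝ), 0 < a₁ → 0 < a₂ →
      ∀ (f : EuclideanSpace ℝ (Fin 2) → ℂ), Admissible (d := 1) f →
        ∀ (x₁ x₂ : ℝ), ∃ K : ℝ → ℂ,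
          (∀ α : ℝ, HasFinitePart (ellipticalRadon (d := 1) ![a₁, a₂] f (!₂[α]))
            (|a₁⁻¹ * (α - x₁)| ^ 2 + (a₂ ^ 2)⁻¹ * x₂ ^ 2) (K α)) ∧
          Integrable K ∧
          f (!₂[x₁, x₂]) = -((|x₂| / (Real.pi ^ 2 * a₁ ^ 2 * a₂ ^ 2) : ℝ) : ℂ) * ∫ α, K α) := by
  refine ⟨fun d _ a ha f hf => ?_, fun a₁ a₂ h₁ h₂ f hf x₁ x₂ => ?_⟩
  · have ha' : ∀ i, a i ≠ 0 := fun i => (ha i).ne'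
    refine ⟨fun u t _ => ?_, fun x' xn => ⟨fun α => ?_, ?_, ?_⟩⟩
    · rw [ellipticalRadon_eq ha' hf]
      exact hasDeltaIntegral_ellipsoidalRadius ha' hf u t
    · exact lambdaConverges_ellipticalRadon ha' hf α d _
    · exact integrable_Lambda_ellipticalRadon ha' hf x' xn
    · exact inversion_formula ha' hf x' xn
  · exact ⟨_, hasFinitePart_planar_ellipticalRadon h₁.ne' h₂.ne' hf x₁ x₂,
      (integrable_planar_Lambda_ellipticalRadon h₁.ne' h₂.ne' hf x₁ x₂).const_mul _,
      planar_inversion_formula h₁.ne' h₂.ne' hf x₁ x₂⟩
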